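/- Let $d\ge 2$, $T\in(0,\infty)$, let $\mathbb{T}^d$ be the torus of period $1$, and let $V:[0,T]\times\mathbb{T}^d\to\mathbb{R}^d$ satisfy (A1) $V\in L^{p^*}([0,T];L^p(\mathbb{T}^d;\mathbb{R}^d))$ for some $p,p^*$ with $\frac dp+\frac2{p^*}\le1$, $2\le p^*<\infty$, $d<p\le\infty$; (A2) $\nabla\cdot V\in L^{q^*}([0,T];L^q(\mathbb{T}^d))$ for some $q,q^*$ with $\frac d{2q}+\frac1{q^*}\le1$, $1\le q^*<\infty$, $\frac d2<q\le\infty$. Write $(V*\rho)(x,t)=\int_{\mathbb{T}^d}V(t,x-y)\rho(y,t)\,dy$, and let $\mathrm{Ent}(\mathbb{T}^d)$ be the set of $f\in L^1(\mathbb{T}^d)$ with $f\ge0$ a.e. and $\int f\log f\,dx<\infty$. For $g\in L^2(\mathbb{T}^d\times[0,T];\mathbb{R}^d)$ and $\rho_0\in\mathrm{Ent}(\mathbb{T}^d)$, a nonnegative $\rho\in L^\infty([0,T];L^1(\mathbb{T}^d))$ is a weak solution of $$\partial_t\rho=\Delta\rho-\nabla\cdot(\rho V*\rho)-\nabla\cdot(\sqrt\rho\,g),\qquad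 \rho(0)=\rho_0,$$ if $\nabla\sqrt\rho\in L^2([0,T];L^2(\mathbb{T}^d;\mathbb{R}^d))$, the weak divergence $\nabla\cdot(\rho V*\rho)$ exists in $L^1(\mathbb{T}^d\times[0,T])$ (which is automatic under (A1)), and there is a Lebesgue-null set $\mathcal N\subseteq(0,T]$ such that for all $t\in[0,T]\setminus\mathcal N$ and $\psi\in C^\infty(\mathbb{T}^d)$ $$\int\rho(x,t)\psi\,dx=-\int_0^t\!\!\int2\sqrt\rho\,\nabla\sqrt\rho\cdot\nabla\psi\,dx\,ds+\int_0^t\!\!\int\sqrt\rho\,g\cdot\nabla\psi\,dx\,ds-\int_0^t\!\!\int\nabla\cdot(\rho V*\rho)\,\psi\,dx\,ds+\int\rho_0\psi\,dx .$$ Define $$I(\rho)=\tfrac12\inf\Big\{\|g\|^2_{L^2(\mathbb{T}^d\times[0,T];\mathbb{R}^d)}:\ \rho\text{ is a weak solution with control }g\text{ and initial value }\rho(\cdot,0)\Big\}$$ if $\rho\in C([0,T];L^1(\mathbb{T}^d))$ and $\rho(\cdot,0)\in\mathrm{Ent}(\mathbb{T}^d)$, with $\inf\emptyset=\infty$, and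 $I(\rho)=\infty$ otherwise. Define $$I_{par}(\rho)=\sup_{\psi\in C^\infty(\mathbb{T}^d\times[0,T])}\Big(\int\psi(x,T)\rho(x,T)\,dx-\int\psi(x,0)\rho(x,0)\,dx-\int_0^T\!\!\int\rho\,\partial_t\psi\,dx\,dt-\int_0^T\!\!\int\rho\,\Delta\psi\,dx\,dt-\int_0^T\!\!\int(\rho V*\rho)\cdot\nabla\psi\,dx\,dt-\tfrac12\int_0^T\!\!\int\rho|\nabla\psi|^2\,dx\,dt\Big).$$ Then for every $\rho\in C([0,T];L^1(\mathbb{T}^d))$ with $I(\rho)<\infty$ and $I_{par}(\rho)<\infty$, $$I(\rho)=I_{par}(\rho).$$ -/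

import Mathlib

open MeasureTheory Set Filter
open scoped Topology ContDiff

namespace DeanKawasaki

/-- The `d`-dimensional torus of period `1`; its `volume` is Lebesgue measure (total mass `1`). -/
abbrev Torus (d : ℕ) : Type := UnitAddTorus (Fin d)

/-- Values of vector fields on the torus: `ℝ^d` with the Euclidean norm. -/
abbrev Vec (d : ℕ) : Type := EuclideanSpace ℝ (Fin d)

/-- The covering projection `ℝ^d → 𝕋^d`. -/
def proj {d : ℕ} (y : Fin d → ℝ) : Torus d := fun i => (y i : UnitAddCircle)

/-- `φ ∈ C^∞(𝕋^d)`: the periodic lift of `φ` to `ℝ^d` is smooth. -/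
def SmoothTorus {d : ℕ} (φ : Torus d → ℝ) : Prop :=
  ContDiff ℝ ∞ (fun y : Fin d → ℝ => φ (proj y))

/-- Smooth functions of time and space. The elements of `C^∞(𝕋^d × [0,T])` are the restrictions of
these to `[0,T]`. -/
def SmoothSpaceTime {d : ℕ} (ψ : ℝ → Torus d → ℝ) : Prop :=
  ContDiff ℝ ∞ (fun z : ℝ × (Fin d → ℝ) => ψ z.1 (proj z.2))

/-- The partial derivative in the `i`-th coordinate direction of a function on the torus. -/
noncomputable def partialD {d : ℕ} (i : Fin d) (φ : Torus d → ℝ) (x : Torus d) : ℝ :=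
  deriv (fun s : ℝ => φ (x + Pi.single i (s : UnitAddCircle))) 0

/-- The gradient `∇φ`. -/
noncomputable def grad {d : ℕ} (φ : Torus d → ℝ) (x : Torus d) : Vec d :=
  WithLp.toLp 2 (fun i => partialD i φ x)

/-- The Laplacian `Δφ`. -/
noncomputable def laplacian {d : ℕ} (φ : Torus d → ℝ) (x : Torus d) : ℝ :=
  ∑ i, partialD i (partialD i φ) x

/-- `G ∈ L¹` is the weak gradient of `f ∈ L¹` on the torus. -/
def HasWeakGrad {d : ℕ} (f : Torus d → ℝ) (G : Torus d → Vec d) : Prop :=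
  Integrable f ∧ Integrable G ∧
    ∀ φ : Torus d → ℝ, SmoothTorus φ → ∫ x, φ x • G x = - ∫ x, f x • grad φ x

/-- `w ∈ L¹` is the weak divergence of the vector field `F ∈ L¹` on the torus. -/
def HasWeakDiv {d : ℕ} (F : Torus d → Vec d) (w : Torus d → ℝ) : Prop :=
  Integrable F ∧ Integrable w ∧
    ∀ φ : Torus d → ℝ, SmoothTorus φ → ∫ x, w x * φ x = - ∫ x, inner ℝ (F x) (grad φ x)

/-- Lebesgue measure on the time interval `[0,T]`. -/
noncomputable def timeMeasure (T : ℝ) : Measure ℝ := volume.restrict (Icc 0 T)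

/-- Lebesgue measure on `[0,T] × 𝕋^d`. -/
noncomputable def spaceTime (T : ℝ) (d : ℕ) : Measure (ℝ × Torus d) :=
  (timeMeasure T).prod volume

/-- `f ∈ L^r([0,T]; L^s(𝕋^d))`. -/
def MemMixedLp {d : ℕ} {E : Type*} [NormedAddCommGroup E] (T : ℝ) (r s : ENNReal)
    (f : ℝ → Torus d → E) : Prop :=
  AEStronglyMeasurable (Function.uncurry f) (spaceTime T d) ∧
    eLpNorm (fun t => eLpNorm (f t) s volume) r (timeMeasure T) < ⊤

/-- `ρ ∈ C([0,T]; L¹(𝕋^d))`, given by a space-time measurable representative. -/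
structure ContinuousInL1 {d : ℕ} (T : ℝ) (ρ : ℝ → Torus d → ℝ) : Prop where
  measurable : AEStronglyMeasurable (Function.uncurry ρ) (spaceTime T d)
  integrable : ∀ t ∈ Icc 0 T, Integrable (ρ t)
  continuous : ∀ t ∈ Icc 0 T,
    Tendsto (fun s => ∫ x, |ρ s x - ρ t x|) (𝓝[Icc 0 T] t) (𝓝 0)

/-- Assumption (A1) on the kernel: `V ∈ L^{p*}([0,T]; L^p)` with `d/p + 2/p* ≤ 1`,
`2 ≤ p* < ∞` and `d < p ≤ ∞`. -/
def AssumptionA1 {d : ℕ} (T : ℝ) (V : ℝ → Torus d → Vec d) : Prop :=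
  ∃ p ps : ENNReal, (d : ENNReal) / p + 2 / ps ≤ 1 ∧ 2 ≤ ps ∧ ps < ⊤ ∧ (d : ENNReal) < p ∧
    MemMixedLp T ps p V

/-- Assumption (A2) on the kernel: `∇ · V ∈ L^{q*}([0,T]; L^q)` with `d/(2q) + 1/q* ≤ 1`,
`1 ≤ q* < ∞` and `d/2 < q ≤ ∞`. -/
def AssumptionA2 {d : ℕ} (T : ℝ) (V : ℝ → Torus d → Vec d) : Prop :=
  ∃ q qs : ENNReal, (d : ENNReal) / (2 * q) + 1 / qs ≤ 1 ∧ 1 ≤ qs ∧ qs < ⊤ ∧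
    (d : ENNReal) / 2 < q ∧
    ∃ divV : ℝ → Torus d → ℝ, MemMixedLp T qs q divV ∧
      ∀ᵐ t ∂(timeMeasure T), HasWeakDiv (V t) (divV t)

/-- The convolution `(V ∗ f)(x) = ∫ V(x - y) f(y) dy`. -/
noncomputable def conv {d : ℕ} (V : Torus d → Vec d) (f : Torus d → ℝ) : Torus d → Vec d :=
  convolution f V (ContinuousLinearMap.lsmul ℝ ℝ) volume

/-- The interaction flux `ρ(t) V(t) ∗ ρ(t)`. -/
noncomputable def flux {d : ℕ} (V : ℝ → Torus d → Vec d) (ρ : ℝ → Torus d → ℝ) (t : ℝ)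
    (x : Torus d) : Vec d :=
  ρ t x • conv (V t) (ρ t) x

/-- The space `Ent(𝕋^d)`: nonnegative `L¹` functions with finite entropy. Since `r log r` is
bounded below and the torus has finite measure, finiteness is integrability. -/
def Ent {d : ℕ} (f : Torus d → ℝ) : Prop :=
  Integrable f ∧ (∀ᵐ x, 0 ≤ f x) ∧ Integrable (fun x => f x * Real.log (f x))

/-- Weak solutions of the skeleton equation
`∂ₜρ = Δρ - ∇·(ρ V∗ρ) - ∇·(√ρ g)`, `ρ(0) = ρ₀`, on `[0,T] × 𝕋^d`.
Here `G = ∇√ρ` and `w = ∇·(ρ V∗ρ)`. -/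
structure IsWeakSolution {d : ℕ} (T : ℝ) (V : ℝ → Torus d → Vec d) (g : ℝ → Torus d → Vec d)
    (ρ₀ : Torus d → ℝ) (ρ : ℝ → Torus d → ℝ) : Prop where
  memLp : MemMixedLp T ⊤ 1 ρ
  nonneg : ∀ᵐ t ∂(timeMeasure T), ∀ᵐ x, 0 ≤ ρ t x
  weak_form : ∃ (G : ℝ → Torus d → Vec d) (w : ℝ → Torus d → ℝ),
    MemLp (Function.uncurry G) 2 (spaceTime T d) ∧
    (∀ᵐ t ∂(timeMeasure T), HasWeakGrad (fun x => Real.sqrt (ρ t x)) (G t)) ∧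
    Integrable (Function.uncurry w) (spaceTime T d) ∧
    (∀ᵐ t ∂(timeMeasure T), HasWeakDiv (flux V ρ t) (w t)) ∧
    ∃ N : Set ℝ, N ⊆ Ioc 0 T ∧ volume N = 0 ∧
      ∀ t ∈ Icc 0 T \ N, ∀ ψ : Torus d → ℝ, SmoothTorus ψ →
        ∫ x, ρ t x * ψ x =
          - (∫ s in (0 : ℝ)..t, ∫ x, 2 * Real.sqrt (ρ s x) * inner ℝ (G s x) (grad ψ x))
          + (∫ s in (0 : ℝ)..t, ∫ x, Real.sqrt (ρ s x) * inner ℝ (g s x) (grad ψ x))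
          - (∫ s in (0 : ℝ)..t, ∫ x, w s x * ψ x)
          + ∫ x, ρ₀ x * ψ x

open Classical in
/-- The Dean–Kawasaki rate function `I(ρ) = ½ inf ‖g‖²_{L²}` over the controls `g` for which `ρ`
solves the skeleton equation started from `ρ(0)`; it is `∞` if there is no such control, if
`ρ ∉ C([0,T]; L¹)` or if `ρ(0) ∉ Ent(𝕋^d)`. -/
noncomputable def rateDK {d : ℕ} (T : ℝ) (V : ℝ → Torus d → Vec d) (ρ : ℝ → Torus d → ℝ) :
    ENNReal :=
  if ContinuousInL1 T ρ ∧ Ent (ρ 0) then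
    (1 / 2) * sInf {c : ENNReal | ∃ g : ℝ → Torus d → Vec d,
      MemLp (Function.uncurry g) 2 (spaceTime T d) ∧ IsWeakSolution T V g (ρ 0) ρ ∧
      c = eLpNorm (Function.uncurry g) 2 (spaceTime T d) ^ 2}
  else ⊤

/-- The functional whose supremum over test functions `ψ` is `I_par(ρ)`. -/
noncomputable def parFunctional {d : ℕ} (T : ℝ) (V : ℝ → Torus d → Vec d)
    (ρ : ℝ → Torus d → ℝ) (ψ : ℝ → Torus d → ℝ) : ℝ :=
  (∫ x, ψ T x * ρ T x) - (∫ x, ψ 0 x * ρ 0 x)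
    - (∫ t in (0 : ℝ)..T, ∫ x, ρ t x * deriv (fun s => ψ s x) t)
    - (∫ t in (0 : ℝ)..T, ∫ x, ρ t x * laplacian (ψ t) x)
    - (∫ t in (0 : ℝ)..T, ∫ x, inner ℝ (flux V ρ t x) (grad (ψ t) x))
    - (1 / 2) * ∫ t in (0 : ℝ)..T, ∫ x, ρ t x * ‖grad (ψ t) x‖ ^ 2

/-- The particle-system rate function `I_par(ρ)`, the supremum over `ψ ∈ C^∞(𝕋^d × [0,T])`. -/
noncomputable def ratePar {d : ℕ} (T : ℝ) (V : ℝ → Torus d → Vec d) (ρ : ℝ → Torus d → ℝ) :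
    EReal :=
  sSup {c : EReal | ∃ ψ : ℝ → Torus d → ℝ, SmoothSpaceTime ψ ∧
    c = ((parFunctional T V ρ ψ : ℝ) : EReal)}

end DeanKawasaki

namespace DeanKawasaki

variable {d : ℕ}

/-! ### Calculus on the torus -/

/-! Finiteness of `rateDK` supplies one control `g`. Testing the skeleton equation with a smooth
space-time function `ψ` and writing `u = √ρ ∇ψ`, everything in `parFunctional` except the quadratic
term collapses to the pairing with `g`, so the functional equals `⟨g, u⟩ - ½‖u‖²` in `L²([0,T] ×
𝕋^d)` (`IsWeakSolution.parFunctional_eq`). Completing the square bounds `ratePar` by `½‖k‖²` for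
every control `k`.

For the reverse bound, let `q` be the orthogonal projection of `g` onto the closure of the fields
`√ρ ∇ψ`. It has the same pairings with these fields, hence is again a control
(`IsWeakSolution.congr_control`). By continuity the supremum may be taken over the closure, which
contains `q`, and the value there is `½‖q‖²`. Thus `ratePar = ½‖q‖²`, and `q` has least norm among
the controls (`IsWeakSolution.exists_optimal`).

Two analytic points carry the identity. The diffusion term needs `∇ρ = 2√ρ ∇√ρ` when `√ρ` has only a
weak gradient in `L²`; this follows from Parseval, mode by mode (`HasWeakPartial.integral_sq_mul`).
The equation is given for test functions of space at almost every time; Fubini extends it to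
functions of time and space (`weakForm_spaceTime`), and continuity in `L¹` reaches the final time.
-/

lemma isOpenQuotientMap_proj : IsOpenQuotientMap (proj : (Fin d → ℝ) → Torus d) :=
  IsOpenQuotientMap.piMap fun _ => QuotientAddGroup.isOpenQuotientMap_mk

lemma proj_surjective : Function.Surjective (proj : (Fin d → ℝ) → Torus d) :=
  isOpenQuotientMap_proj.surjective

lemma proj_add_single (y : Fin d → ℝ) (i : Fin d) (s : ℝ) :
    proj y + Pi.single i (s : UnitAddCircle) = proj (y + s • Pi.single i 1) := by
  funext j
  by_cases h : j = i
  · subst h; simp [proj]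
  · simp [proj, h]

/-- The periodic lift of a function of time and space. -/
def lift (ψ : ℝ → Torus d → ℝ) (z : ℝ × (Fin d → ℝ)) : ℝ := ψ z.1 (proj z.2)

/-- The time derivative of a function of time and space. -/
noncomputable def timeD (ψ : ℝ → Torus d → ℝ) (t : ℝ) (x : Torus d) : ℝ :=
  deriv (fun s => ψ s x) t

lemma partialD_eq_lineDeriv (i : Fin d) (ψ : ℝ → Torus d → ℝ) (t : ℝ) (y : Fin d → ℝ) :
    partialD i (ψ t) (proj y) = lineDeriv ℝ (lift ψ) (t, y) (0, Pi.single i 1) := by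
  simp only [partialD, lineDeriv, proj_add_single]
  congr 1
  funext s
  simp [lift]

lemma timeD_eq_lineDeriv (ψ : ℝ → Torus d → ℝ) (t : ℝ) (y : Fin d → ℝ) :
    timeD ψ t (proj y) = lineDeriv ℝ (lift ψ) (t, y) (1, 0) := by
  -- `lineDeriv` differentiates at parameter `0`, `timeD` at `t`; a shift reconciles them.
  have := deriv_comp_const_add (f := fun s => ψ s (proj y)) t 0
  simp only [add_zero] at this
  simp only [timeD, lineDeriv, ← this]
  congr 1
  funext s
  simp [lift]

namespace SmoothSpaceTime

variable {ψ χ : ℝ → Torus d → ℝ}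

lemma contDiff_lift (h : SmoothSpaceTime ψ) : ContDiff ℝ ∞ (lift ψ) := h

lemma differentiable_lift (h : SmoothSpaceTime ψ) : Differentiable ℝ (lift ψ) :=
  h.contDiff_lift.differentiable (by simp)

lemma continuous (h : SmoothSpaceTime ψ) : Continuous (Function.uncurry ψ) := by
  have := (IsOpenQuotientMap.id (X := ℝ)).prodMap (isOpenQuotientMap_proj (d := d))
  rw [← this.continuous_comp_iff]
  exact h.contDiff_lift.continuous

lemma smoothTorus (h : SmoothSpaceTime ψ) (t : ℝ) : SmoothTorus (ψ t) :=
  h.contDiff_lift.comp (contDiff_const.prodMk contDiff_id : ContDiff ℝ ∞ fun y => (t, y))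

lemma partialD_proj (h : SmoothSpaceTime ψ) (i : Fin d) (t : ℝ) (y : Fin d → ℝ) :
    DeanKawasaki.partialD i (ψ t) (proj y) = fderiv ℝ (lift ψ) (t, y) (0, Pi.single i 1) := by
  rw [partialD_eq_lineDeriv, (h.differentiable_lift _).lineDeriv_eq_fderiv]

lemma timeD_proj (h : SmoothSpaceTime ψ) (t : ℝ) (y : Fin d → ℝ) :
    timeD ψ t (proj y) = fderiv ℝ (lift ψ) (t, y) (1, 0) := by
  rw [timeD_eq_lineDeriv, (h.differentiable_lift _).lineDeriv_eq_fderiv]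

lemma lift_partialD (h : SmoothSpaceTime ψ) (i : Fin d) :
    lift (fun t => DeanKawasaki.partialD i (ψ t)) =
      fun z => fderiv ℝ (lift ψ) z (0, Pi.single i 1) :=
  funext fun z => h.partialD_proj i z.1 z.2

lemma lift_timeD (h : SmoothSpaceTime ψ) :
    lift (timeD ψ) = fun z => fderiv ℝ (lift ψ) z (1, 0) :=
  funext fun z => h.timeD_proj z.1 z.2

lemma contDiff_fderiv (h : SmoothSpaceTime ψ) : ContDiff ℝ ∞ (fderiv ℝ (lift ψ)) :=
  h.contDiff_lift.fderiv_right (by simp)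

lemma partialD (h : SmoothSpaceTime ψ) (i : Fin d) :
    SmoothSpaceTime (fun t => DeanKawasaki.partialD i (ψ t)) := by
  change ContDiff ℝ ∞ (lift fun t => DeanKawasaki.partialD i (ψ t))
  rw [h.lift_partialD]
  exact h.contDiff_fderiv.clm_apply contDiff_const

lemma timeD (h : SmoothSpaceTime ψ) : SmoothSpaceTime (timeD ψ) := by
  change ContDiff ℝ ∞ (lift (DeanKawasaki.timeD ψ))
  rw [h.lift_timeD]
  exact h.contDiff_fderiv.clm_apply contDiff_const

lemma hasDerivAt (h : SmoothSpaceTime ψ) (t : ℝ) (x : Torus d) :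
    HasDerivAt (fun s => ψ s x) (DeanKawasaki.timeD ψ t x) t := by
  obtain ⟨y, rfl⟩ := proj_surjective x
  refine DifferentiableAt.hasDerivAt ?_
  exact (h.differentiable_lift (t, y)).comp t
    (by fun_prop : DifferentiableAt ℝ (fun s : ℝ => (s, y)) t)

/-- Symmetry of the second derivative of the smooth periodic lift. -/
lemma timeD_partialD (h : SmoothSpaceTime ψ) (i : Fin d) (t : ℝ) (x : Torus d) :
    DeanKawasaki.timeD (fun s => DeanKawasaki.partialD i (ψ s)) t x =
      DeanKawasaki.partialD i (DeanKawasaki.timeD ψ t) x := by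
  obtain ⟨y, rfl⟩ := proj_surjective x
  rw [(h.partialD i).timeD_proj, h.timeD.partialD_proj, h.lift_partialD, h.lift_timeD]
  have hd : DifferentiableAt ℝ (fderiv ℝ (lift ψ)) (t, y) :=
    h.contDiff_fderiv.differentiable (by simp) _
  have key : ∀ v w : ℝ × (Fin d → ℝ), fderiv ℝ (fun z => fderiv ℝ (lift ψ) z v) (t, y) w =
      fderiv ℝ (fderiv ℝ (lift ψ)) (t, y) w v := fun v w => by
    rw [fderiv_clm_apply hd (differentiableAt_const v)]
    simp
  rw [key, key]
  exact (h.contDiff_lift.contDiffAt.isSymmSndFDerivAt (by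
    rw [minSmoothness_of_isRCLikeNormedField]
    exact WithTop.coe_le_coe.2 (le_top : (2 : ℕ∞) ≤ ⊤))).eq _ _

lemma add (h : SmoothSpaceTime ψ) (h' : SmoothSpaceTime χ) :
    SmoothSpaceTime (fun t x => ψ t x + χ t x) := ContDiff.add h h'

lemma mul (h : SmoothSpaceTime ψ) (h' : SmoothSpaceTime χ) :
    SmoothSpaceTime (fun t x => ψ t x * χ t x) := ContDiff.mul h h'

end SmoothSpaceTime

namespace SmoothTorus

variable {φ χ : Torus d → ℝ}

/-- Lets the spatial calculus be read off from the space-time one. -/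
lemma const_time (h : SmoothTorus φ) : SmoothSpaceTime (fun _ => φ) :=
  ContDiff.comp (g := fun y => φ (proj y)) h contDiff_snd

lemma mul_time (h : SmoothTorus φ) {a : ℝ → ℝ} (ha : ContDiff ℝ ∞ a) :
    SmoothSpaceTime (fun t x => a t * φ x) :=
  SmoothSpaceTime.mul (ψ := fun t _ => a t) (ha.comp contDiff_fst) h.const_time

lemma continuous (h : SmoothTorus φ) : Continuous φ := by
  rw [← isOpenQuotientMap_proj.continuous_comp_iff]
  exact ContDiff.continuous h

lemma partialD (h : SmoothTorus φ) (i : Fin d) : SmoothTorus (DeanKawasaki.partialD i φ) :=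
  (h.const_time.partialD i).smoothTorus 0

lemma mul (h : SmoothTorus φ) (h' : SmoothTorus χ) : SmoothTorus (fun x => φ x * χ x) :=
  ContDiff.mul h h'

lemma hasDerivAt (h : SmoothTorus φ) (i : Fin d) (x : Torus d) :
    HasDerivAt (fun s : ℝ => φ (x + Pi.single i (s : UnitAddCircle)))
      (DeanKawasaki.partialD i φ x) 0 := by
  obtain ⟨y, rfl⟩ := proj_surjective x
  refine DifferentiableAt.hasDerivAt ?_
  simp only [proj_add_single]
  exact DifferentiableAt.comp (g := fun y => φ (proj y)) (0 : ℝ)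
    (ContDiff.differentiable h (by simp) _) (by fun_prop)

end SmoothTorus

lemma partialD_add {φ χ : Torus d → ℝ} (h : SmoothTorus φ) (h' : SmoothTorus χ) (i : Fin d)
    (x : Torus d) :
    partialD i (fun x => φ x + χ x) x = partialD i φ x + partialD i χ x :=
  ((h.hasDerivAt i x).add (h'.hasDerivAt i x)).deriv

lemma partialD_mul {φ χ : Torus d → ℝ} (h : SmoothTorus φ) (h' : SmoothTorus χ) (i : Fin d)
    (x : Torus d) :
    partialD i (fun x => φ x * χ x) x = partialD i φ x * χ x + φ x * partialD i χ x := by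
  have h0 : x + Pi.single i (0 : UnitAddCircle) = x := by simp
  have := ((h.hasDerivAt i x).mul (h'.hasDerivAt i x)).deriv
  rw [QuotientAddGroup.mk_zero, h0] at this
  exact this

lemma partialD_const_mul (c : ℝ) (φ : Torus d → ℝ) (i : Fin d) (x : Torus d) :
    partialD i (fun x => c * φ x) x = c * partialD i φ x :=
  deriv_const_mul_field c

lemma grad_add {φ χ : Torus d → ℝ} (h : SmoothTorus φ) (h' : SmoothTorus χ) (x : Torus d) :
    grad (fun x => φ x + χ x) x = grad φ x + grad χ x := by
  ext i; simp [grad, partialD_add h h']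

lemma grad_const_mul (c : ℝ) (φ : Torus d → ℝ) (x : Torus d) :
    grad (fun x => c * φ x) x = c • grad φ x := by
  ext i; simp [grad, partialD_const_mul]

lemma SmoothTorus.continuous_grad {φ : Torus d → ℝ} (h : SmoothTorus φ) :
    Continuous (grad φ) :=
  (PiLp.continuous_toLp 2 _).comp (continuous_pi fun i => (h.partialD i).continuous)

lemma SmoothSpaceTime.continuous_grad {ψ : ℝ → Torus d → ℝ} (h : SmoothSpaceTime ψ) :
    Continuous (fun z : ℝ × Torus d => grad (ψ z.1) z.2) :=
  (PiLp.continuous_toLp 2 _).comp (continuous_pi fun i => (h.partialD i).continuous)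

/-- A jointly continuous function is bounded on `[0,T] × 𝕋^d`. -/
lemma exists_bound {E : Type*} [NormedAddCommGroup E] {f : ℝ × Torus d → E} (hf : Continuous f)
    (T : ℝ) : ∃ C : ℝ, 0 ≤ C ∧ ∀ t ∈ Icc 0 T, ∀ x, ‖f (t, x)‖ ≤ C := by
  obtain ⟨C, hC⟩ := ((isCompact_Icc (a := (0 : ℝ)) (b := T)).prod
    (isCompact_univ (X := Torus d))).exists_bound_of_continuousOn hf.continuousOn
  exact ⟨max C 0, le_max_right _ _, fun t ht x =>
    (hC (t, x) ⟨ht, mem_univ x⟩).trans (le_max_left _ _)⟩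

/-! ### Fourier series and the chain rule for `ρ = (√ρ)²` -/

/-- At period `1` the normalising factor is `1`, so Fourier theory for the Haar probability measure
applies to `volume`. -/
lemma volume_unitAddCircle : (volume : Measure UnitAddCircle) = AddCircle.haarAddCircle := by
  simp [AddCircle.volume_eq_smul_haarAddCircle]

instance : IsProbabilityMeasure (volume : Measure UnitAddCircle) := by
  rw [volume_unitAddCircle]; infer_instance

lemma volume_torus :
    (volume : Measure (Torus d)) = Measure.pi fun _ => AddCircle.haarAddCircle := by
  rw [volume_pi, volume_unitAddCircle]

/-- The Fourier coefficients with respect to Lebesgue measure on the torus. -/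
noncomputable def coeff (f : Torus d → ℂ) (n : Fin d → ℤ) : ℂ :=
  ∫ x, UnitAddTorus.mFourier (-n) x * f x

/-- Parseval's identity, transferred from `Lp` classes to functions. -/
lemma hasSum_coeff {f g : Torus d → ℂ} (hf : MemLp f 2) (hg : MemLp g 2) :
    HasSum (fun n => starRingEnd ℂ (coeff f n) * coeff g n)
      (∫ x, starRingEnd ℂ (f x) * g x) := by
  unfold coeff
  rw [volume_torus] at *
  have h1 : ∀ {f : Torus d → ℂ}
      (hf : MemLp f 2 (Measure.pi fun _ => AddCircle.haarAddCircle)) (n : Fin d → ℤ),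
      ∫ x, UnitAddTorus.mFourier (-n) x * f x ∂(Measure.pi fun _ => AddCircle.haarAddCircle) =
        UnitAddTorus.mFourierCoeff (hf.toLp f) n := fun hf n => by
    refine integral_congr_ae ?_
    filter_upwards [hf.coeFn_toLp] with x hx
    rw [hx, smul_eq_mul]
  simp only [h1 hf, h1 hg]
  have h2 : ∫ x, starRingEnd ℂ (f x) * g x ∂(Measure.pi fun _ => AddCircle.haarAddCircle) =
      ∫ x, starRingEnd ℂ ((hf.toLp f) x) * (hg.toLp g) x
        ∂(Measure.pi fun _ => AddCircle.haarAddCircle) := by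
    refine integral_congr_ae ?_
    filter_upwards [hf.coeFn_toLp, hg.coeFn_toLp] with x hx hx'
    rw [hx, hx']
  rw [h2]
  exact UnitAddTorus.hasSum_prod_mFourierCoeff (hf.toLp f) (hg.toLp g)

lemma mFourier_proj (n : Fin d → ℤ) (y : Fin d → ℝ) :
    UnitAddTorus.mFourier n (proj y) = ∏ j, Complex.exp (2 * Real.pi * Complex.I * n j * y j) := by
  simp [UnitAddTorus.mFourier, proj]

lemma contDiff_mFourier (n : Fin d → ℤ) :
    ContDiff ℝ ∞ (fun y : Fin d → ℝ => UnitAddTorus.mFourier n (proj y)) := by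
  simp only [mFourier_proj]
  refine contDiff_prod fun j _ => ContDiff.cexp (contDiff_const.mul ?_)
  exact Complex.ofRealCLM.contDiff.comp (contDiff_apply ℝ ℝ j)

/-- Test functions are real, so characters enter the weak formulations through their real and
imaginary parts. -/
lemma smoothTorus_re_mFourier (n : Fin d → ℤ) :
    SmoothTorus (fun x => (UnitAddTorus.mFourier n x).re) :=
  Complex.reCLM.contDiff.comp (contDiff_mFourier n)

lemma smoothTorus_im_mFourier (n : Fin d → ℤ) :
    SmoothTorus (fun x => (UnitAddTorus.mFourier n x).im) :=
  Complex.imCLM.contDiff.comp (contDiff_mFourier n)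

/-- A character is multiplicative: translation by `s` along the `i`-th axis multiplies it by
`exp(2πi nᵢ s)`. -/
lemma hasDerivAt_mFourier (n : Fin d → ℤ) (i : Fin d) (x : Torus d) :
    HasDerivAt (fun s : ℝ => UnitAddTorus.mFourier n (x + Pi.single i (s : UnitAddCircle)))
      (2 * Real.pi * Complex.I * n i * UnitAddTorus.mFourier n x) 0 := by
  have h1 : ∀ s : ℝ, UnitAddTorus.mFourier n (x + Pi.single i (s : UnitAddCircle)) =
      UnitAddTorus.mFourier n x * Complex.exp (2 * Real.pi * Complex.I * n i * s) := by
    intro s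
    have h2 : UnitAddTorus.mFourier n (Pi.single i (s : UnitAddCircle)) =
        Complex.exp (2 * Real.pi * Complex.I * n i * s) := by
      have := proj_add_single (0 : Fin d → ℝ) i s
      have h0 : proj (0 : Fin d → ℝ) = 0 := by funext j; simp [proj]
      rw [h0, zero_add, zero_add] at this
      rw [this, mFourier_proj, Finset.prod_eq_single i]
      · simp
      · intro j _ hj; simp [hj]
      · simp
    rw [← h2]
    simp [UnitAddTorus.mFourier, fourier_apply, Finset.prod_mul_distrib, smul_add,
      AddCircle.toCircle_add]
  have h3 : HasDerivAt (fun s : ℝ => 2 * Real.pi * Complex.I * n i * (s : ℂ))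
      (2 * Real.pi * Complex.I * n i) 0 := by
    simpa using (Complex.ofRealCLM.hasDerivAt (x := (0 : ℝ))).const_mul
      (2 * Real.pi * Complex.I * n i : ℂ)
  have h4 := (h3.cexp).const_mul (UnitAddTorus.mFourier n x)
  exact (h4.congr_deriv (by simp; ring)).congr_of_eventuallyEq (Eventually.of_forall h1)

lemma partialD_re_mFourier (n : Fin d → ℤ) (i : Fin d) (x : Torus d) :
    partialD i (fun x => (UnitAddTorus.mFourier n x).re) x =
      -(2 * Real.pi * n i) * (UnitAddTorus.mFourier n x).im := by
  have := (Complex.reCLM.hasFDerivAt.comp_hasDerivAt (0 : ℝ) (hasDerivAt_mFourier n i x)).deriv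
  refine this.trans ?_
  simp

lemma partialD_im_mFourier (n : Fin d → ℤ) (i : Fin d) (x : Torus d) :
    partialD i (fun x => (UnitAddTorus.mFourier n x).im) x =
      2 * Real.pi * n i * (UnitAddTorus.mFourier n x).re := by
  have := (Complex.imCLM.hasFDerivAt.comp_hasDerivAt (0 : ℝ) (hasDerivAt_mFourier n i x)).deriv
  refine this.trans ?_
  simp

lemma _root_.MeasureTheory.MemLp.mul_continuous_torus {f φ : Torus d → ℝ} {p : ENNReal}
    (hf : MemLp f p) (hφ : Continuous φ) : MemLp (fun x => f x * φ x) p := by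
  have hφ' : MemLp φ ⊤ := by
    obtain ⟨C, -, hC⟩ := exists_bound (f := fun z : ℝ × Torus d => φ z.2) (by fun_prop) 0
    exact memLp_top_of_bound hφ.aestronglyMeasurable C
      (ae_of_all _ fun x => hC 0 (by simp) x)
  exact hφ'.mul hf

lemma _root_.MeasureTheory.Integrable.mul_continuous_torus {f φ : Torus d → ℝ}
    (hf : Integrable f) (hφ : Continuous φ) : Integrable (fun x => f x * φ x) := by
  rw [← memLp_one_iff_integrable] at *
  exact hf.mul_continuous_torus hφ

lemma exists_bound_torus {E : Type*} [NormedAddCommGroup E] {f : Torus d → E}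
    (hf : Continuous f) : ∃ C : ℝ, 0 ≤ C ∧ ∀ x, ‖f x‖ ≤ C := by
  obtain ⟨C, h0, hC⟩ := exists_bound (f := fun z : ℝ × Torus d => f z.2) (by fun_prop) 0
  exact ⟨C, h0, hC 0 (by simp)⟩

lemma _root_.MeasureTheory.Integrable.smul_continuous_torus {f : Torus d → ℝ}
    {F : Torus d → Vec d} (hf : Integrable f) (hF : Continuous F) :
    Integrable (fun x => f x • F x) := by
  obtain ⟨C, -, hC⟩ := exists_bound_torus hF
  exact hf.smul_bdd C hF.aestronglyMeasurable (ae_of_all _ hC)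

lemma _root_.MeasureTheory.Integrable.continuous_smul_torus {f : Torus d → ℝ}
    {F : Torus d → Vec d} (hF : Integrable F) (hf : Continuous f) :
    Integrable (fun x => f x • F x) := by
  obtain ⟨C, -, hC⟩ := exists_bound_torus hf
  exact hF.bdd_smul C hf.aestronglyMeasurable (ae_of_all _ hC)

/-- `v` is the weak derivative of `u` in the direction `i`. -/
def HasWeakPartial (i : Fin d) (u v : Torus d → ℝ) : Prop :=
  ∀ φ : Torus d → ℝ, SmoothTorus φ → ∫ x, v x * φ x = - ∫ x, u x * partialD i φ x

lemma HasWeakGrad.hasWeakPartial {u : Torus d → ℝ} {G : Torus d → Vec d} (h : HasWeakGrad u G)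
    (i : Fin d) : HasWeakPartial i u (fun x => G x i) := by
  intro φ hφ
  have h1 := congrArg (EuclideanSpace.proj (𝕜 := ℝ) i) (h.2.2 φ hφ)
  rw [map_neg, ← ContinuousLinearMap.integral_comp_comm,
    ← ContinuousLinearMap.integral_comp_comm] at h1
  · simpa [grad, mul_comm] using h1
  · exact h.1.smul_continuous_torus hφ.continuous_grad
  · exact h.2.1.continuous_smul_torus hφ.continuous

lemma integrable_re_im {f : Torus d → ℝ} (hf : Integrable f) (n : Fin d → ℤ) :
    Integrable (fun x => f x * (UnitAddTorus.mFourier n x).re) ∧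
      Integrable (fun x => f x * (UnitAddTorus.mFourier n x).im) :=
  ⟨hf.mul_continuous_torus (smoothTorus_re_mFourier n).continuous,
    hf.mul_continuous_torus (smoothTorus_im_mFourier n).continuous⟩

lemma coeff_ofReal {f : Torus d → ℝ} (hf : Integrable f) (n : Fin d → ℤ) :
    coeff (fun x => (f x : ℂ)) n =
      ((∫ x, f x * (UnitAddTorus.mFourier (-n) x).re : ℝ) : ℂ) +
      ((∫ x, f x * (UnitAddTorus.mFourier (-n) x).im : ℝ) : ℂ) * Complex.I := by
  obtain ⟨h1, h2⟩ := integrable_re_im hf (-n)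
  rw [coeff, ← integral_complex_ofReal, ← integral_complex_ofReal, ← integral_mul_const,
    ← integral_add h1.ofReal (h2.ofReal.mul_const _)]
  refine integral_congr_ae (ae_of_all _ fun x => ?_)
  apply Complex.ext <;> simp [mul_comm]

/-- The definition of `v` is tested with `φ` times the character of index `-n`; the product rule
yields the two terms, and differentiating the character gives `-2πi nᵢ`. -/
lemma HasWeakPartial.coeff_mul {i : Fin d} {u v φ : Torus d → ℝ} (h : HasWeakPartial i u v)
    (hu : Integrable u) (hv : Integrable v) (hφ : SmoothTorus φ) (n : Fin d → ℤ) :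
    coeff (fun x => ((v x * φ x : ℝ) : ℂ)) n =
      - coeff (fun x => ((u x * partialD i φ x : ℝ) : ℂ)) n
      + 2 * Real.pi * Complex.I * n i * coeff (fun x => ((u x * φ x : ℝ) : ℂ)) n := by
  have hQ : Integrable (fun x => u x * partialD i φ x) :=
    hu.mul_continuous_torus (hφ.partialD i).continuous
  have hP : Integrable (fun x => u x * φ x) := hu.mul_continuous_torus hφ.continuous
  have hR : Integrable (fun x => v x * φ x) := hv.mul_continuous_torus hφ.continuous
  obtain ⟨hQ1, hQ2⟩ := integrable_re_im hQ (-n)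
  obtain ⟨hP1, hP2⟩ := integrable_re_im hP (-n)
  have e1 : ∫ x, v x * φ x * (UnitAddTorus.mFourier (-n) x).re =
      - (∫ x, u x * partialD i φ x * (UnitAddTorus.mFourier (-n) x).re)
      - 2 * Real.pi * n i * ∫ x, u x * φ x * (UnitAddTorus.mFourier (-n) x).im := by
    have := h _ (hφ.mul (smoothTorus_re_mFourier (-n)))
    simp only [partialD_mul hφ (smoothTorus_re_mFourier (-n)), partialD_re_mFourier] at this
    rw [← integral_const_mul, ← integral_neg, ← integral_sub hQ1.fun_neg (hP2.const_mul _)]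
    simp only [mul_assoc] at this ⊢
    rw [this, ← integral_neg]
    refine integral_congr_ae (ae_of_all _ fun x => ?_)
    simp; ring
  have e2 : ∫ x, v x * φ x * (UnitAddTorus.mFourier (-n) x).im =
      - (∫ x, u x * partialD i φ x * (UnitAddTorus.mFourier (-n) x).im)
      + 2 * Real.pi * n i * ∫ x, u x * φ x * (UnitAddTorus.mFourier (-n) x).re := by
    have := h _ (hφ.mul (smoothTorus_im_mFourier (-n)))
    simp only [partialD_mul hφ (smoothTorus_im_mFourier (-n)), partialD_im_mFourier] at this
    rw [← integral_const_mul, ← integral_neg, ← integral_add hQ2.fun_neg (hP1.const_mul _)]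
    simp only [mul_assoc] at this ⊢
    rw [this, ← integral_neg]
    refine integral_congr_ae (ae_of_all _ fun x => ?_)
    simp; ring
  rw [coeff_ofReal hQ, coeff_ofReal hP, coeff_ofReal hR, e1, e2]
  push_cast
  linear_combination (-2 * Real.pi * n i *
    ((∫ x, u x * φ x * (UnitAddTorus.mFourier (-n) x).im : ℝ) : ℂ)) * Complex.I_mul_I

/-- The chain rule `∂ᵢ(u²) = 2 u ∂ᵢu` in weak form. -/
lemma HasWeakPartial.integral_sq_mul {i : Fin d} {u v φ : Torus d → ℝ} (h : HasWeakPartial i u v)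
    (hu : MemLp u 2) (hv : MemLp v 2) (hφ : SmoothTorus φ) :
    ∫ x, u x ^ 2 * partialD i φ x = - ∫ x, 2 * u x * v x * φ x := by
  have hu1 : Integrable u := hu.integrable one_le_two
  have hv1 : Integrable v := hv.integrable one_le_two
  have hP : MemLp (fun x => u x * φ x) 2 := hu.mul_continuous_torus hφ.continuous
  have hQ : MemLp (fun x => u x * partialD i φ x) 2 :=
    hu.mul_continuous_torus (hφ.partialD i).continuous
  have hR : MemLp (fun x => v x * φ x) 2 := hv.mul_continuous_torus hφ.continuous
  have hone : SmoothTorus (fun _ : Torus d => (1 : ℝ)) := contDiff_const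
  have hpone : ∀ x : Torus d, partialD i (fun _ : Torus d => (1 : ℝ)) x = 0 := fun x => by
    simp [partialD]
  -- The claim says that `∂ᵢ(u · uφ)` has integral zero, that is, `(uφ)v + (u ∂ᵢφ)u + (vφ)u` does.
  -- Each product is a pairing of two `L²` functions, hence a Parseval series.
  have key := ((hasSum_coeff hP.ofReal hv.ofReal).add (hasSum_coeff hQ.ofReal hu.ofReal)).add
    (hasSum_coeff hR.ofReal hu.ofReal)
  -- The series cancel term by term: `coeff_mul` with `φ = 1` gives `v̂ = 2πi nᵢ û`, and conjugation
  -- flips the sign of the same factor in the coefficient of `vφ`.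
  have hzero : ∀ n : Fin d → ℤ,
      starRingEnd ℂ (coeff (fun x => ((u x * φ x : ℝ) : ℂ)) n) * coeff (fun x => (v x : ℂ)) n +
      starRingEnd ℂ (coeff (fun x => ((u x * partialD i φ x : ℝ) : ℂ)) n) *
        coeff (fun x => (u x : ℂ)) n +
      starRingEnd ℂ (coeff (fun x => ((v x * φ x : ℝ) : ℂ)) n) * coeff (fun x => (u x : ℂ)) n
        = 0 := by
    intro n
    have h1 := h.coeff_mul hu1 hv1 hφ n
    have h2 := h.coeff_mul hu1 hv1 hone n
    have h3 : coeff (fun _ : Torus d => (0 : ℂ)) n = 0 := by simp [coeff]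
    simp only [mul_one, hpone, mul_zero, Complex.ofReal_zero, h3, neg_zero, zero_add] at h2
    rw [h1, h2]
    simp only [map_add, map_neg, map_mul, Complex.conj_I, Complex.conj_ofReal, map_ofNat,
      map_intCast]
    ring
  have htot := (key.congr_fun fun n => (hzero n).symm).unique hasSum_zero
  have i1 : Integrable (fun x => u x * φ x * v x) := hP.integrable_mul hv
  have i2 : Integrable (fun x => u x * partialD i φ x * u x) := hQ.integrable_mul hu
  have i3 : Integrable (fun x => v x * φ x * u x) := hR.integrable_mul hu
  have hreal : (∫ x, u x * φ x * v x) + (∫ x, u x * partialD i φ x * u x)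
      + ∫ x, v x * φ x * u x = 0 := by
    rw [← Complex.ofReal_inj]
    push_cast
    rw [← htot, ← integral_complex_ofReal, ← integral_complex_ofReal, ← integral_complex_ofReal]
    simp
  have e1 : ∫ x, u x ^ 2 * partialD i φ x = ∫ x, u x * partialD i φ x * u x := by
    congr 1; funext x; ring
  have e2 : ∫ x, 2 * u x * v x * φ x = (∫ x, u x * φ x * v x) + ∫ x, v x * φ x * u x := by
    rw [← integral_add i1 i3]; congr 1; funext x; ring
  rw [e1, e2]
  linarith

/-- The chain rule `∇(u²) = 2 u ∇u` in weak form, tested against a gradient. -/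
lemma HasWeakGrad.integral_sq_mul_laplacian {u φ : Torus d → ℝ} {G : Torus d → Vec d}
    (h : HasWeakGrad u G) (hu : MemLp u 2) (hG : MemLp G 2) (hφ : SmoothTorus φ) :
    ∫ x, u x ^ 2 * laplacian φ x = - ∫ x, 2 * u x * inner ℝ (G x) (grad φ x) := by
  have hGi : ∀ i, MemLp (fun x => G x i) 2 := fun i =>
    (EuclideanSpace.proj (𝕜 := ℝ) i).comp_memLp' hG
  have hu2 : Integrable (fun x => u x ^ 2) := by simpa [sq] using! hu.integrable_mul hu
  have huG : ∀ i, Integrable (fun x => 2 * u x * G x i * partialD i φ x) := fun i => by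
    refine Integrable.mul_continuous_torus ?_ (hφ.partialD i).continuous
    simpa only [mul_assoc] using! (hu.integrable_mul (hGi i)).const_mul 2
  simp only [laplacian, Finset.mul_sum, PiLp.inner_apply, grad, RCLike.inner_apply, conj_trivial]
  rw [integral_finsetSum _ fun i _ =>
    hu2.mul_continuous_torus ((hφ.partialD i).partialD i).continuous]
  have e : ∀ x, ∑ i, 2 * u x * (partialD i φ x * G x i) =
      ∑ i, 2 * u x * G x i * partialD i φ x := fun x =>
    Finset.sum_congr rfl fun i _ => by ring
  simp only [e]
  rw [integral_finsetSum _ fun i _ => huG i, ← Finset.sum_neg_distrib]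
  -- The scalar chain rule is applied with test function `∂ᵢφ`, one coordinate at a time.
  exact Finset.sum_congr rfl fun i _ =>
    (h.hasWeakPartial i).integral_sq_mul hu (hGi i) (hφ.partialD i)

variable {T : ℝ}

/-! ### Integration over space-time -/

instance : IsFiniteMeasure (timeMeasure T) := by unfold timeMeasure; infer_instance

instance : IsFiniteMeasure (spaceTime T d) := by unfold spaceTime; infer_instance

lemma ae_mem_timeMeasure : ∀ᵐ t ∂(timeMeasure T), t ∈ Icc 0 T :=
  ae_restrict_mem measurableSet_Icc

lemma ae_fst_mem_spaceTime : ∀ᵐ z ∂(spaceTime T d), z.1 ∈ Icc 0 T :=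
  Measure.quasiMeasurePreserving_fst.ae ae_mem_timeMeasure

lemma intervalIntegral_eq_timeMeasure (hT : 0 ≤ T) (f : ℝ → ℝ) :
    ∫ s in (0 : ℝ)..T, f s = ∫ s, f s ∂(timeMeasure T) := by
  rw [intervalIntegral.integral_of_le hT, timeMeasure, integral_Icc_eq_integral_Ioc]

lemma intervalIntegral_integral_eq (hT : 0 ≤ T) {f : ℝ × Torus d → ℝ}
    (hf : Integrable f (spaceTime T d)) :
    ∫ s in (0 : ℝ)..T, ∫ x, f (s, x) = ∫ z, f z ∂(spaceTime T d) := by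
  rw [intervalIntegral_eq_timeMeasure hT, spaceTime, integral_prod _ hf]

/-- Moving the upper limit `t` into the integrand as a cutoff prepares the exchange with an outer
integral over `t`. -/
lemma intervalIntegral_integral_eq_ite {t : ℝ} (ht : t ∈ Icc 0 T) {f : ℝ × Torus d → ℝ}
    (hf : Integrable f (spaceTime T d)) :
    ∫ s in (0 : ℝ)..t, ∫ x, f (s, x) =
      ∫ z, (if z.1 ≤ t then f z else 0) ∂(spaceTime T d) := by
  have hm : MeasurableSet {z : ℝ × Torus d | z.1 ≤ t} :=
    measurableSet_le measurable_fst measurable_const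
  have h1 : Integrable (fun z : ℝ × Torus d => if z.1 ≤ t then f z else 0) (spaceTime T d) :=
    hf.indicator hm
  rw [spaceTime, integral_prod _ h1, intervalIntegral.integral_of_le ht.1,
    ← integral_Icc_eq_integral_Ioc]
  have h2 : ∀ s, ∫ x, (if (s, x).1 ≤ t then f (s, x) else 0) =
      (Iic t).indicator (fun s => ∫ x, f (s, x)) s := fun s => by
    by_cases h : s ≤ t <;> simp [h]
  simp only [h2]
  rw [integral_indicator measurableSet_Iic, timeMeasure, Measure.restrict_restrict measurableSet_Iic]
  congr 2
  ext s
  simp only [mem_Icc, mem_inter_iff, mem_Iic]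
  exact ⟨fun h => ⟨h.2, h.1, h.2.trans ht.2⟩, fun h => ⟨h.2.1, h.1⟩⟩

/-- Integrating a time derivative from a variable starting time to `T`, under an integral. -/
lemma integral_timeD_swap {Z : Type*} [MeasurableSpace Z] {ν : Measure Z} [SFinite ν]
    {f : Z → ℝ} {a : Z → ℝ} {p : Z → Torus d} (hf : Integrable f ν) (ha : Measurable a)
    (hp : Measurable p) (haT : ∀ᵐ z ∂ν, a z ∈ Icc 0 T)
    {η : ℝ → Torus d → ℝ} (hη : SmoothSpaceTime η) :
    Integrable (fun s => ∫ z, (if a z ≤ s then f z * timeD η s (p z) else 0) ∂ν)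
      (timeMeasure T) ∧
    ∫ s, ∫ z, (if a z ≤ s then f z * timeD η s (p z) else 0) ∂ν ∂(timeMeasure T) =
      ∫ z, f z * (η T (p z) - η (a z) (p z)) ∂ν := by
  obtain ⟨C, -, hC⟩ := exists_bound hη.timeD.continuous T
  have hint : Integrable (Function.uncurry fun (s : ℝ) (z : Z) =>
      if a z ≤ s then f z * timeD η s (p z) else 0) ((timeMeasure T).prod ν) := by
    have h1 : Integrable (fun q : ℝ × Z => f q.2) ((timeMeasure T).prod ν) := hf.comp_snd _
    have h2 : Integrable (fun q : ℝ × Z => f q.2 * timeD η q.1 (p q.2))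
        ((timeMeasure T).prod ν) := by
      refine h1.mul_bdd (c := C) ?_ ?_
      · exact (hη.timeD.continuous.measurable.comp
          (measurable_fst.prodMk (hp.comp measurable_snd))).aestronglyMeasurable
      · filter_upwards [Measure.quasiMeasurePreserving_fst.ae
          (ae_mem_timeMeasure (T := T))] with q hq
        exact hC _ hq _
    exact h2.indicator (measurableSet_le (ha.comp measurable_snd) measurable_fst)
  refine ⟨hint.integral_prod_left, ?_⟩
  -- After Fubini, `s` runs over `[a z, T]` for fixed `z`, and the fundamental theorem of calculus
  -- applies.
  rw [integral_integral_swap hint]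
  refine integral_congr_ae ?_
  filter_upwards [haT] with z hz
  have h1 : ∀ s, (if a z ≤ s then f z * timeD η s (p z) else 0) =
      (Ici (a z)).indicator (fun s => f z * timeD η s (p z)) s := fun s => rfl
  simp only [h1]
  rw [integral_indicator measurableSet_Ici, timeMeasure,
    Measure.restrict_restrict measurableSet_Ici]
  have h2 : Ici (a z) ∩ Icc 0 T = Icc (a z) T := by
    ext s
    simp only [mem_inter_iff, mem_Ici, mem_Icc]
    exact ⟨fun h => ⟨h.1, h.2.2⟩, fun h => ⟨h.1, hz.1.trans h.1, h.2⟩⟩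
  rw [h2, integral_Icc_eq_integral_Ioc, ← intervalIntegral.integral_of_le hz.2,
    intervalIntegral.integral_const_mul]
  congr 1
  refine intervalIntegral.integral_eq_sub_of_hasDerivAt (f := fun s => η s (p z))
    (fun s _ => hη.hasDerivAt s (p z)) ?_
  exact (hη.timeD.continuous.comp (by fun_prop : Continuous fun s : ℝ => (s, p z))).intervalIntegrable
    _ _

lemma _root_.MeasureTheory.Integrable.mul_continuous_spaceTime {f : ℝ × Torus d → ℝ}
    {η : ℝ × Torus d → ℝ} (hf : Integrable f (spaceTime T d)) (hη : Continuous η) :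
    Integrable (fun z => f z * η z) (spaceTime T d) := by
  obtain ⟨C, -, hC⟩ := exists_bound hη T
  refine hf.mul_bdd (c := C) hη.aestronglyMeasurable ?_
  filter_upwards [ae_fst_mem_spaceTime] with z hz
  exact hC _ hz _

/-- The weak form `∂ₜρ = -∇·A - w` against functions of space only implies the weak form against
functions of space and time. -/
lemma weakForm_spaceTime {ρ : ℝ → Torus d → ℝ}
    {ρ₀ : Torus d → ℝ} {A : Fin d → ℝ × Torus d → ℝ} {w : ℝ × Torus d → ℝ}
    (hT : 0 ≤ T) (hρ₀ : Integrable ρ₀)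
    (hA : ∀ i, Integrable (A i) (spaceTime T d))
    (hw : Integrable w (spaceTime T d))
    (P : ℝ → Prop) (hP : ∀ᵐ t ∂(timeMeasure T), P t) (hPT : P T)
    (h : ∀ t ∈ Icc 0 T, P t → ∀ φ : Torus d → ℝ, SmoothTorus φ →
      ∫ x, ρ t x * φ x = (∫ x, ρ₀ x * φ x)
        + ∑ i, (∫ s in (0 : ℝ)..t, ∫ x, A i (s, x) * partialD i φ x)
        - ∫ s in (0 : ℝ)..t, ∫ x, w (s, x) * φ x)
    {ψ : ℝ → Torus d → ℝ} (hψ : SmoothSpaceTime ψ) :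
    (∫ x, ρ T x * ψ T x) - (∫ x, ρ₀ x * ψ 0 x) - ∫ t in (0 : ℝ)..T, ∫ x, ρ t x * timeD ψ t x =
      ∑ i, (∫ z, A i z * partialD i (ψ z.1) z.2 ∂(spaceTime T d))
        - ∫ z, w z * ψ z.1 z.2 ∂(spaceTime T d) := by
  have slice : ∀ {η : ℝ → Torus d → ℝ}, SmoothSpaceTime η → ∀ {f : ℝ × Torus d → ℝ},
      Integrable f (spaceTime T d) → ∀ s,
      Integrable (fun z : ℝ × Torus d => f z * η s z.2) (spaceTime T d) := fun hη f hf s =>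
    hf.mul_continuous_spaceTime ((hη.smoothTorus s).continuous.comp continuous_snd)
  have hint : ∀ {η : ℝ → Torus d → ℝ}, SmoothSpaceTime η → ∀ {f : ℝ × Torus d → ℝ},
      Integrable f (spaceTime T d) →
      Integrable (fun z : ℝ × Torus d => f z * η z.1 z.2) (spaceTime T d) := fun hη f hf =>
    hf.mul_continuous_spaceTime hη.continuous
  -- The initial datum acts from time `0`; the flux and `w` at a space-time point act from that
  -- point's own time, whence `a = 0` here and `a = Prod.fst` below.
  have h0 := integral_timeD_swap (T := T) hρ₀ (measurable_const (a := (0 : ℝ))) measurable_id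
    (ae_of_all _ fun _ => ⟨le_rfl, hT⟩) hψ
  simp only [id] at h0
  have hw' := integral_timeD_swap (T := T) hw measurable_fst measurable_snd
    ae_fst_mem_spaceTime hψ
  have hA' := fun i => integral_timeD_swap (T := T) (hA i) measurable_fst measurable_snd
    ae_fst_mem_spaceTime (hψ.partialD i)
  -- The weak form at time `t`, tested with `∂ₜψ(t)`, is integrated over `t`; exchanging integrals
  -- turns `∂ₜψ` into increments of `ψ` up to time `T`.
  have e1 : ∫ t in (0 : ℝ)..T, ∫ x, ρ t x * timeD ψ t x =
      (∫ x, ρ₀ x * (ψ T x - ψ 0 x))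
      + ∑ i, (∫ z, A i z * (partialD i (ψ T) z.2 - partialD i (ψ z.1) z.2) ∂(spaceTime T d))
      - ∫ z, w z * (ψ T z.2 - ψ z.1 z.2) ∂(spaceTime T d) := by
    rw [intervalIntegral_eq_timeMeasure hT, ← h0.2, ← hw'.2,
      Finset.sum_congr rfl fun i _ => (hA' i).2.symm, ← integral_finsetSum _ fun i _ => (hA' i).1,
      ← integral_add h0.1 (integrable_finsetSum _ fun i _ => (hA' i).1),
      ← integral_sub (h0.1.fun_add (integrable_finsetSum _ fun i _ => (hA' i).1)) hw'.1]
    refine integral_congr_ae ?_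
    filter_upwards [hP, ae_mem_timeMeasure] with t htP ht
    rw [h t ht htP _ (hψ.timeD.smoothTorus t)]
    congr 2
    · simp [ht.1]
    · refine Finset.sum_congr rfl fun i _ => ?_
      simp only [← hψ.timeD_partialD]
      exact intervalIntegral_integral_eq_ite ht (slice (hψ.partialD i).timeD (hA i) t)
    · exact intervalIntegral_integral_eq_ite ht (slice hψ.timeD hw t)
  have hTmem : T ∈ Icc 0 T := ⟨hT, le_rfl⟩
  -- The weak form at `T`, tested with `ψ(T)`, cancels every term of `e1` that contains `ψ(T)`.
  rw [e1, h T hTmem hPT _ (hψ.smoothTorus T), intervalIntegral_integral_eq hT (slice hψ hw T),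
    Finset.sum_congr rfl fun i _ =>
      intervalIntegral_integral_eq hT (slice (hψ.partialD i) (hA i) T)]
  simp only [mul_sub]
  rw [integral_sub (hρ₀.mul_continuous_torus (hψ.smoothTorus T).continuous)
    (hρ₀.mul_continuous_torus (hψ.smoothTorus 0).continuous),
    integral_sub (slice hψ hw T) (hint hψ hw),
    Finset.sum_congr rfl fun i _ => integral_sub (slice (hψ.partialD i) (hA i) T)
      (hint (hψ.partialD i) (hA i)), Finset.sum_sub_distrib]
  ring

/-! ### The weak formulation of the skeleton equation in space-time -/

lemma integrable_of_memMixedLp {ρ : ℝ → Torus d → ℝ} (h : MemMixedLp T ⊤ 1 ρ) :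
    Integrable (Function.uncurry ρ) (spaceTime T d) := by
  refine ⟨h.1, ?_⟩
  rw [HasFiniteIntegral, spaceTime, lintegral_prod _ h.1.enorm]
  have hb := ae_le_eLpNormEssSup (f := fun t => eLpNorm (ρ t) 1 volume) (μ := timeMeasure T)
  have h2 := h.2
  rw [eLpNorm_exponent_top] at h2
  calc ∫⁻ t, ∫⁻ x, ‖Function.uncurry ρ (t, x)‖ₑ ∂volume ∂(timeMeasure T)
      ≤ ∫⁻ _, eLpNormEssSup (fun t => eLpNorm (ρ t) 1 volume) (timeMeasure T)
          ∂(timeMeasure T) := by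
        refine lintegral_mono_ae ?_
        filter_upwards [hb] with t ht
        simpa [eLpNorm_one_eq_lintegral_enorm] using ht
    _ < ⊤ := by
        rw [lintegral_const]
        exact ENNReal.mul_lt_top h2 (measure_lt_top _ _)

/-- No sign condition is needed: `Real.sqrt` vanishes on negative numbers, so its square is at most
`|f|`. -/
lemma _root_.MeasureTheory.Integrable.memLp_sqrt {α : Type*} [MeasurableSpace α] {ν : Measure α}
    {f : α → ℝ} (hf : Integrable f ν) : MemLp (fun x => Real.sqrt (f x)) 2 ν := by
  have hm : AEStronglyMeasurable (fun x => Real.sqrt (f x)) ν :=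
    Real.continuous_sqrt.comp_aestronglyMeasurable hf.1
  rw [memLp_two_iff_integrable_sq hm]
  refine hf.mono (hm.pow 2) (ae_of_all _ fun x => ?_)
  rcases le_total 0 (f x) with h | h
  · rw [Real.sq_sqrt h]
  · simp [Real.sqrt_eq_zero_of_nonpos h]

lemma memLp_slice {G : ℝ → Torus d → Vec d}
    (hG : MemLp (Function.uncurry G) 2 (spaceTime T d)) :
    ∀ᵐ t ∂(timeMeasure T), MemLp (G t) 2 := by
  have h1 := (memLp_two_iff_integrable_sq_norm hG.1).1 hG
  filter_upwards [h1.prod_right_ae, hG.1.prodMk_left] with t h2 h3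
  exact (memLp_two_iff_integrable_sq_norm h3).2 h2

section Inner

variable {α : Type*} [MeasurableSpace α] {ν : Measure α} {r : α → ℝ} {g X : α → Vec d}

lemma integrable_mul_coord (hr : MemLp r 2 ν) (hg : MemLp g 2 ν) (i : Fin d) :
    Integrable (fun z => r z * g z i) ν :=
  hr.integrable_mul ((EuclideanSpace.proj (𝕜 := ℝ) i).comp_memLp' hg)

lemma integrable_mul_inner (hr : MemLp r 2 ν) (hg : MemLp g 2 ν)
    (hX : AEStronglyMeasurable X ν) {C : ℝ} (hC : ∀ᵐ z ∂ν, ‖X z‖ ≤ C) :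
    Integrable (fun z => r z * inner ℝ (g z) (X z)) ν := by
  refine hr.integrable_mul (q := 2) ?_
  refine MemLp.of_le_mul (c := C) hg (hg.1.inner hX) ?_
  filter_upwards [hC] with z hz
  rw [mul_comm]
  exact (norm_inner_le_norm _ _).trans (by gcongr)

/-- Collects diffusion and control into the single flux `√ρ (g - 2G)` in coordinates, as
`weakForm_spaceTime` requires. The measure is general so as to cover both `[0,t]` and `[0,T]`. -/
lemma sum_integral_coord {G : α → Vec d} (hr : MemLp r 2 ν) (hg : MemLp g 2 ν) (hG : MemLp G 2 ν)
    (hX : AEStronglyMeasurable X ν) {C : ℝ} (hC : ∀ᵐ z ∂ν, ‖X z‖ ≤ C) :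
    ∑ i, ∫ z, r z * (g z i - 2 * G z i) * X z i ∂ν =
      -(∫ z, 2 * r z * inner ℝ (G z) (X z) ∂ν) + ∫ z, r z * inner ℝ (g z) (X z) ∂ν := by
  have hXi : ∀ i, ∀ᵐ z ∂ν, ‖X z i‖ ≤ C := fun i => by
    filter_upwards [hC] with z hz
    exact (PiLp.norm_apply_le (X z) i).trans hz
  have hXm : ∀ i, AEStronglyMeasurable (fun z => X z i) ν := fun i =>
    (EuclideanSpace.proj (𝕜 := ℝ) i).continuous.comp_aestronglyMeasurable hX
  have hI : ∀ i, Integrable (fun z => r z * (g z i - 2 * G z i) * X z i) ν := fun i => by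
    refine Integrable.mul_bdd (c := C) ?_ (hXm i) (hXi i)
    refine ((integrable_mul_coord hr hg i).sub
      ((integrable_mul_coord hr hG i).const_mul 2)).congr (ae_of_all _ fun z => ?_)
    simp only [Pi.sub_apply]; ring
  have h2 : Integrable (fun z => 2 * r z * inner ℝ (G z) (X z)) ν := by
    simpa only [mul_assoc] using (integrable_mul_inner hr hG hX hC).const_mul 2
  rw [← integral_finsetSum _ fun i _ => hI i, ← integral_neg,
    ← integral_add h2.fun_neg (integrable_mul_inner hr hg hX hC)]
  refine integral_congr_ae (ae_of_all _ fun z => ?_)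
  simp only [PiLp.inner_apply, RCLike.inner_apply, conj_trivial, Finset.mul_sum,
    ← Finset.sum_neg_distrib, ← Finset.sum_add_distrib]
  exact Finset.sum_congr rfl fun i _ => by ring

end Inner

lemma intervalIntegral_integral_eq_setIntegral {t : ℝ} (ht : t ∈ Icc 0 T) {f : ℝ × Torus d → ℝ}
    (hf : Integrable f (spaceTime T d)) :
    ∫ s in (0 : ℝ)..t, ∫ x, f (s, x) = ∫ z in {z | z.1 ≤ t}, f z ∂(spaceTime T d) := by
  rw [intervalIntegral_integral_eq_ite ht hf,
    ← integral_indicator (measurableSet_le measurable_fst measurable_const)]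
  rfl

/-- Space integrals of a curve in `C([0,T]; L¹)` against a bounded function are continuous. -/
lemma ContinuousInL1.tendsto_integral_mul {ρ : ℝ → Torus d → ℝ} (hρ : ContinuousInL1 T ρ)
    {φ : Torus d → ℝ} (hφ : Continuous φ) {t : ℝ} (ht : t ∈ Icc 0 T) :
    Tendsto (fun s => ∫ x, ρ s x * φ x) (𝓝[Icc 0 T] t) (𝓝 (∫ x, ρ t x * φ x)) := by
  obtain ⟨C, -, hC⟩ := exists_bound_torus hφ
  rw [tendsto_iff_norm_sub_tendsto_zero]
  have h0 : Tendsto (fun s => (∫ x, |ρ s x - ρ t x|) * C) (𝓝[Icc 0 T] t) (𝓝 0) := by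
    simpa using (hρ.continuous t ht).mul_const C
  refine squeeze_zero' (Eventually.of_forall fun _ => norm_nonneg _) ?_ h0
  filter_upwards [self_mem_nhdsWithin] with s hs
  have hs' := hρ.integrable s hs
  have ht' := hρ.integrable t ht
  rw [← integral_sub (hs'.mul_continuous_torus hφ) (ht'.mul_continuous_torus hφ),
    ← integral_mul_const]
  refine norm_integral_le_of_norm_le ((hs'.sub ht').abs.mul_const C) (ae_of_all _ fun x => ?_)
  rw [← sub_mul, norm_mul, Real.norm_eq_abs]
  exact mul_le_mul_of_nonneg_left (hC x) (abs_nonneg _)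

/-- The complement of a null set is dense, so `T` is a limit of admissible times even if `T ∈ N`. -/
lemma nhdsWithin_diff_null_neBot (hT : 0 < T) {N : Set ℝ} (hN : volume N = 0) :
    (𝓝[Icc 0 T \ N] T).NeBot := by
  rw [← mem_closure_iff_nhdsWithin_neBot]
  have h1 : Dense Nᶜ := Measure.dense_of_ae (measure_eq_zero_iff_ae_notMem.1 hN)
  have h2 : closure (Ioo 0 T) ⊆ closure (Ioo 0 T ∩ Nᶜ) :=
    closure_minimal (h1.open_subset_closure_inter isOpen_Ioo) isClosed_closure
  rw [closure_Ioo hT.ne] at h2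
  exact closure_mono (t := Icc 0 T \ N) (fun x hx => ⟨Ioo_subset_Icc_self hx.1, hx.2⟩)
    (h2 ⟨hT.le, le_rfl⟩)

lemma continuousOn_primitive_integral (hT : 0 ≤ T) {f : ℝ × Torus d → ℝ}
    (hf : Integrable f (spaceTime T d)) :
    ContinuousOn (fun t => ∫ s in (0 : ℝ)..t, ∫ x, f (s, x)) (Icc 0 T) := by
  have := intervalIntegral.continuousOn_primitive_interval (μ := volume) (a := 0) (b := T)
    (f := fun s => ∫ x, f (s, x)) (by rw [uIcc_of_le hT]; exact hf.integral_prod_left)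
  rwa [uIcc_of_le hT] at this

/-- An identity between a curve in `C([0,T]; L¹)` tested against `φ` and a continuous function
that holds off a null set holds at the final time. -/
lemma ContinuousInL1.eq_final {ρ : ℝ → Torus d → ℝ} (hρ : ContinuousInL1 T ρ) (hT : 0 < T)
    {φ : Torus d → ℝ} (hφ : Continuous φ) {N : Set ℝ} (hN : volume N = 0) {F : ℝ → ℝ}
    (hF : ContinuousOn F (Icc 0 T)) (h : ∀ t ∈ Icc 0 T \ N, ∫ x, ρ t x * φ x = F t) :
    ∫ x, ρ T x * φ x = F T := by
  have : (𝓝[Icc 0 T \ N] T).NeBot := nhdsWithin_diff_null_neBot hT hN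
  have hTm : T ∈ Icc 0 T := ⟨hT.le, le_rfl⟩
  refine tendsto_nhds_unique
    ((hρ.tendsto_integral_mul hφ hTm).mono_left (nhdsWithin_mono T (sdiff_subset (t := N)))) ?_
  refine ((hF T hTm).tendsto.mono_left (nhdsWithin_mono T (sdiff_subset (t := N)))).congr' ?_
  filter_upwards [self_mem_nhdsWithin] with t ht
  exact (h t ht).symm

lemma ae_bound_grad {ψ : ℝ → Torus d → ℝ} (hψ : SmoothSpaceTime ψ) (T : ℝ) :
    ∃ C : ℝ, ∀ᵐ z ∂(spaceTime T d), ‖grad (ψ z.1) z.2‖ ≤ C := by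
  obtain ⟨C, -, hC⟩ := exists_bound hψ.continuous_grad T
  refine ⟨C, ?_⟩
  filter_upwards [ae_fst_mem_spaceTime] with z hz
  exact hC _ hz _

/-- The vector field `√ρ ∇ψ`. -/
noncomputable def sqrtGrad (ρ ψ : ℝ → Torus d → ℝ) (z : ℝ × Torus d) : Vec d :=
  Real.sqrt (ρ z.1 z.2) • grad (ψ z.1) z.2

lemma memLp_sqrtGrad {ρ ψ : ℝ → Torus d → ℝ}
    (hρ : Integrable (Function.uncurry ρ) (spaceTime T d)) (hψ : SmoothSpaceTime ψ) :
    MemLp (sqrtGrad ρ ψ) 2 (spaceTime T d) := by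
  obtain ⟨C, hC⟩ := ae_bound_grad hψ T
  exact (memLp_top_of_bound hψ.continuous_grad.aestronglyMeasurable C hC).smul hρ.memLp_sqrt

/-- The functional depends on `ψ` only through the field `√ρ ∇ψ`, and as a linear minus a quadratic
term; this makes the variational problem Hilbertian. -/
lemma IsWeakSolution.parFunctional_eq {V : ℝ → Torus d → Vec d} {ρ : ℝ → Torus d → ℝ}
    {g : ℝ → Torus d → Vec d} (hT : 0 < T) (hρ : ContinuousInL1 T ρ)
    (h : IsWeakSolution T V g (ρ 0) ρ) (hg : MemLp (Function.uncurry g) 2 (spaceTime T d))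
    {ψ : ℝ → Torus d → ℝ} (hψ : SmoothSpaceTime ψ) :
    parFunctional T V ρ ψ =
      (∫ z, inner ℝ (Function.uncurry g z) (sqrtGrad ρ ψ z) ∂(spaceTime T d))
        - 1 / 2 * ∫ z, ‖sqrtGrad ρ ψ z‖ ^ 2 ∂(spaceTime T d) := by
  obtain ⟨G, w, hG, hGw, hw, hww, N, -, hN, hweak⟩ := h.weak_form
  have hρi := integrable_of_memMixedLp h.memLp
  have hr : MemLp (fun z : ℝ × Torus d => Real.sqrt (ρ z.1 z.2)) 2 (spaceTime T d) :=
    hρi.memLp_sqrt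
  set A : Fin d → ℝ × Torus d → ℝ := fun i z =>
    Real.sqrt (ρ z.1 z.2) * (g z.1 z.2 i - 2 * G z.1 z.2 i)
  have hA : ∀ i, Integrable (A i) (spaceTime T d) := fun i => by
    refine ((integrable_mul_coord hr hg i).sub
      ((integrable_mul_coord hr hG i).const_mul 2)).congr (ae_of_all _ fun z => ?_)
    simp only [Pi.sub_apply, A, Function.uncurry]; ring
  have h0 : Integrable (ρ 0) := hρ.integrable 0 ⟨le_rfl, hT.le⟩
  have hform : ∀ t ∈ Icc 0 T \ N, ∀ φ : Torus d → ℝ, SmoothTorus φ →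
      ∫ x, ρ t x * φ x = (∫ x, ρ 0 x * φ x)
        + ∑ i, (∫ s in (0 : ℝ)..t, ∫ x, A i (s, x) * partialD i φ x)
        - ∫ s in (0 : ℝ)..t, ∫ x, Function.uncurry w (s, x) * φ x := by
    intro t ht φ hφ
    rw [hweak t ht φ hφ]
    obtain ⟨C, hC⟩ := ae_bound_grad hφ.const_time T
    have hX : AEStronglyMeasurable (fun z : ℝ × Torus d => grad φ z.2) (spaceTime T d) :=
      hφ.const_time.continuous_grad.aestronglyMeasurable
    have e1 := intervalIntegral_integral_eq_setIntegral ht.1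
      ((integrable_mul_inner hr hG hX hC).const_mul 2)
    have e2 := intervalIntegral_integral_eq_setIntegral ht.1 (integrable_mul_inner hr hg hX hC)
    have e3 := fun i => intervalIntegral_integral_eq_setIntegral ht.1
      ((hA i).mul_continuous_spaceTime (hφ.const_time.partialD i).continuous)
    have e4 := sum_integral_coord (ν := (spaceTime T d).restrict {z | z.1 ≤ t}) (hr.restrict _)
      (hg.restrict _) (hG.restrict _) hX.restrict (ae_restrict_of_ae hC)
    simp only [Function.uncurry, ← mul_assoc] at e1 e2 e3 e4 ⊢
    rw [e1, e2, Finset.sum_congr rfl fun i _ => e3 i]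
    simp only [A, grad] at e4 ⊢
    rw [e4]
    ring
  -- The exceptional set may contain `T`, where `parFunctional` evaluates `ρ`; both sides are
  -- continuous in time.
  have hfinal : ∀ φ : Torus d → ℝ, SmoothTorus φ →
      ∫ x, ρ T x * φ x = (∫ x, ρ 0 x * φ x)
        + ∑ i, (∫ s in (0 : ℝ)..T, ∫ x, A i (s, x) * partialD i φ x)
        - ∫ s in (0 : ℝ)..T, ∫ x, Function.uncurry w (s, x) * φ x := by
    intro φ hφ
    refine hρ.eq_final hT hφ.continuous hN (F := fun t => (∫ x, ρ 0 x * φ x)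
        + ∑ i, (∫ s in (0 : ℝ)..t, ∫ x, A i (s, x) * partialD i φ x)
        - ∫ s in (0 : ℝ)..t, ∫ x, Function.uncurry w (s, x) * φ x) ?_
      fun t ht => hform t ht φ hφ
    refine (continuousOn_const.add (continuousOn_finsetSum _ fun i _ => ?_)).sub ?_
    · exact continuousOn_primitive_integral hT.le
        ((hA i).mul_continuous_spaceTime (hφ.const_time.partialD i).continuous)
    · exact continuousOn_primitive_integral hT.le
        (hw.mul_continuous_spaceTime hφ.const_time.continuous)
  have hmain := weakForm_spaceTime (ρ := ρ) hT.le h0 hA hw (fun t => t ∉ N ∨ t = T)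
    ((ae_restrict_of_ae (measure_eq_zero_iff_ae_notMem.1 hN)).mono fun t ht => Or.inl ht)
    (Or.inr rfl) (fun t ht htN φ hφ => by
      rcases htN with htN | rfl
      · exact hform t ⟨ht, htN⟩ φ hφ
      · exact hfinal φ hφ) hψ
  obtain ⟨C, hC⟩ := ae_bound_grad hψ T
  have hX : AEStronglyMeasurable (fun z : ℝ × Torus d => grad (ψ z.1) z.2) (spaceTime T d) :=
    hψ.continuous_grad.aestronglyMeasurable
  have hsum := sum_integral_coord hr hg hG hX hC
  -- The chain rule with `u = √ρ`; nonnegativity gives `u² = ρ`.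
  have hdiff : ∫ t in (0 : ℝ)..T, ∫ x, ρ t x * laplacian (ψ t) x =
      - ∫ z, 2 * Real.sqrt (ρ z.1 z.2) * inner ℝ (G z.1 z.2) (grad (ψ z.1) z.2)
        ∂(spaceTime T d) := by
    have e1 := intervalIntegral_integral_eq hT.le ((integrable_mul_inner hr hG hX hC).const_mul 2)
    simp only [← mul_assoc, Function.uncurry] at e1
    rw [← e1, ← intervalIntegral.integral_neg, intervalIntegral_eq_timeMeasure hT.le,
      intervalIntegral_eq_timeMeasure hT.le]
    refine integral_congr_ae ?_
    filter_upwards [hGw, h.nonneg, memLp_slice hG, ae_mem_timeMeasure] with t h1 h2 h3 h4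
    rw [← h1.integral_sq_mul_laplacian (hρ.integrable t h4).memLp_sqrt h3 (hψ.smoothTorus t)]
    refine integral_congr_ae ?_
    filter_upwards [h2] with x hx
    rw [Real.sq_sqrt hx]
  have hflux : ∫ t in (0 : ℝ)..T, ∫ x, inner ℝ (flux V ρ t x) (grad (ψ t) x) =
      - ∫ z, Function.uncurry w z * ψ z.1 z.2 ∂(spaceTime T d) := by
    have e1 := intervalIntegral_integral_eq hT.le (hw.mul_continuous_spaceTime hψ.continuous)
    simp only [Function.uncurry] at e1 ⊢
    rw [← e1, ← intervalIntegral.integral_neg, intervalIntegral_eq_timeMeasure hT.le,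
      intervalIntegral_eq_timeMeasure hT.le]
    refine integral_congr_ae ?_
    filter_upwards [hww] with t h1
    rw [h1.2.2 _ (hψ.smoothTorus t), neg_neg]
  have hquad : ∫ t in (0 : ℝ)..T, ∫ x, ρ t x * ‖grad (ψ t) x‖ ^ 2 =
      ∫ z, ‖sqrtGrad ρ ψ z‖ ^ 2 ∂(spaceTime T d) := by
    have hm := memLp_sqrtGrad hρi hψ
    rw [← intervalIntegral_integral_eq hT.le ((memLp_two_iff_integrable_sq_norm hm.1).1 hm),
      intervalIntegral_eq_timeMeasure hT.le, intervalIntegral_eq_timeMeasure hT.le]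
    refine integral_congr_ae ?_
    filter_upwards [h.nonneg] with t h1
    refine integral_congr_ae ?_
    filter_upwards [h1] with x hx
    simp only [sqrtGrad]
    rw [norm_smul, mul_pow, Real.norm_eq_abs, sq_abs, Real.sq_sqrt hx]
  have hinner : ∫ z, inner ℝ (Function.uncurry g z) (sqrtGrad ρ ψ z) ∂(spaceTime T d) =
      ∫ z, Real.sqrt (ρ z.1 z.2) * inner ℝ (Function.uncurry g z) (grad (ψ z.1) z.2)
        ∂(spaceTime T d) := by
    simp only [sqrtGrad, inner_smul_right]
  have hcomm : ∀ a b : Torus d → ℝ, ∫ x, a x * b x = ∫ x, b x * a x := fun a b => by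
    simp only [mul_comm]
  rw [parFunctional, hdiff, hflux, hquad, hinner, hcomm (ψ T), hcomm (ψ 0)]
  simp only [A, grad, timeD, Function.uncurry] at hmain hsum ⊢
  rw [hsum] at hmain
  linarith

/-! ### Optimal controls -/

lemma sqrtGrad_mul_time (ρ : ℝ → Torus d → ℝ) (χ : ℝ → ℝ) (φ : Torus d → ℝ)
    (z : ℝ × Torus d) :
    sqrtGrad ρ (fun t x => χ t * φ x) z = χ z.1 • Real.sqrt (ρ z.1 z.2) • grad φ z.2 := by
  simp only [sqrtGrad]
  rw [grad_const_mul, smul_comm]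

lemma integrable_inner_of_memLp {u v : ℝ × Torus d → Vec d} (hu : MemLp u 2 (spaceTime T d))
    (hv : MemLp v 2 (spaceTime T d)) :
    Integrable (fun z => inner ℝ (u z) (v z)) (spaceTime T d) := by
  refine (L2.integrable_inner (𝕜 := ℝ) (hu.toLp u) (hv.toLp v)).congr ?_
  filter_upwards [hu.coeFn_toLp, hv.coeFn_toLp] with z h1 h2
  rw [h1, h2]

/-- Two controls with the same space-time pairings against the fields `√ρ ∇ψ` have the same
pairings against functions of space at almost every time. -/
lemma ae_integral_inner_eq {ρ : ℝ → Torus d → ℝ}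
    (hρ : Integrable (Function.uncurry ρ) (spaceTime T d)) {g g' : ℝ → Torus d → Vec d}
    (hg : MemLp (Function.uncurry g) 2 (spaceTime T d))
    (hg' : MemLp (Function.uncurry g') 2 (spaceTime T d))
    (heq : ∀ ψ : ℝ → Torus d → ℝ, SmoothSpaceTime ψ →
      ∫ z, inner ℝ (Function.uncurry g' z) (sqrtGrad ρ ψ z) ∂(spaceTime T d) =
        ∫ z, inner ℝ (Function.uncurry g z) (sqrtGrad ρ ψ z) ∂(spaceTime T d))
    {φ : Torus d → ℝ} (hφ : SmoothTorus φ) :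
    ∀ᵐ s, s ∈ Icc 0 T → ∫ x, Real.sqrt (ρ s x) * inner ℝ (g' s x) (grad φ x) =
      ∫ x, Real.sqrt (ρ s x) * inner ℝ (g s x) (grad φ x) := by
  obtain ⟨C, hC⟩ := ae_bound_grad hφ.const_time T
  have hX : AEStronglyMeasurable (fun z : ℝ × Torus d => grad φ z.2) (spaceTime T d) :=
    hφ.const_time.continuous_grad.aestronglyMeasurable
  -- Extension by zero outside `[0,T]` gives locally integrable functions on the line, as the
  -- fundamental lemma of the calculus of variations requires.
  have hb : ∀ {k : ℝ → Torus d → Vec d}, MemLp (Function.uncurry k) 2 (spaceTime T d) →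
      LocallyIntegrable ((Icc 0 T).indicator
        fun s => ∫ x, Real.sqrt (ρ s x) * inner ℝ (k s x) (grad φ x)) := fun hk =>
    (IntegrableOn.integrable_indicator
      (integrable_mul_inner hρ.memLp_sqrt hk hX hC).integral_prod_left
      measurableSet_Icc).locallyIntegrable
  have hχ : ∀ {k : ℝ → Torus d → Vec d}, MemLp (Function.uncurry k) 2 (spaceTime T d) →
      ∀ {χ : ℝ → ℝ}, ContDiff ℝ ∞ χ →
      ∫ s, χ s • (Icc 0 T).indicator
        (fun s => ∫ x, Real.sqrt (ρ s x) * inner ℝ (k s x) (grad φ x)) s =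
      ∫ z, inner ℝ (Function.uncurry k z) (sqrtGrad ρ (fun t x => χ t * φ x) z)
        ∂(spaceTime T d) := by
    intro k hk χ hχ
    have hint : Integrable (fun z => inner ℝ (Function.uncurry k z)
        (sqrtGrad ρ (fun t x => χ t * φ x) z)) (spaceTime T d) :=
      integrable_inner_of_memLp hk (memLp_sqrtGrad hρ (hφ.mul_time hχ))
    rw [spaceTime, integral_prod _ hint, timeMeasure, ← integral_indicator measurableSet_Icc]
    congr 1
    funext s
    by_cases hs : s ∈ Icc 0 T
    · simp only [indicator_of_mem hs, sqrtGrad_mul_time, inner_smul_right, Function.uncurry,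
        smul_eq_mul, integral_const_mul]
    · simp only [indicator_of_notMem hs, smul_zero]
  -- Product test functions `χ(t) φ(x)` with arbitrary smooth `χ` localise the identity in time.
  have key := ae_eq_of_integral_contDiff_smul_eq (hb hg') (hb hg) fun χ h1 _ => by
    rw [hχ hg' h1, hχ hg h1, heq _ (hφ.mul_time h1)]
  filter_upwards [key] with s hs hsT
  simpa only [indicator_of_mem hsT] using hs

/-- A control may be replaced by one with the same pairings against the fields `√ρ ∇ψ`. -/
lemma IsWeakSolution.congr_control {V : ℝ → Torus d → Vec d} {ρ : ℝ → Torus d → ℝ}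
    {ρ₀ : Torus d → ℝ} {g g' : ℝ → Torus d → Vec d} (h : IsWeakSolution T V g ρ₀ ρ)
    (hg : MemLp (Function.uncurry g) 2 (spaceTime T d))
    (hg' : MemLp (Function.uncurry g') 2 (spaceTime T d))
    (heq : ∀ ψ : ℝ → Torus d → ℝ, SmoothSpaceTime ψ →
      ∫ z, inner ℝ (Function.uncurry g' z) (sqrtGrad ρ ψ z) ∂(spaceTime T d) =
        ∫ z, inner ℝ (Function.uncurry g z) (sqrtGrad ρ ψ z) ∂(spaceTime T d)) :
    IsWeakSolution T V g' ρ₀ ρ := by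
  obtain ⟨G, w, hG, hGw, hw, hww, N, hNs, hN, hweak⟩ := h.weak_form
  refine ⟨h.memLp, h.nonneg, G, w, hG, hGw, hw, hww, N, hNs, hN, fun t ht φ hφ => ?_⟩
  rw [hweak t ht φ hφ]
  -- Only the control term changes. The exceptional times depend on `φ`, which is harmless because
  -- `φ` is fixed inside the time integral.
  congr 3
  refine intervalIntegral.integral_congr_ae ?_
  filter_upwards [ae_integral_inner_eq (integrable_of_memMixedLp h.memLp) hg hg' heq hφ]
    with s hs hst
  rw [uIoc_of_le ht.1.1] at hst
  exact (hs ⟨hst.1.le, hst.2.trans ht.1.2⟩).symm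

/-- The space of the fields `√ρ ∇ψ` with `ψ` smooth, in `L²`. -/
noncomputable def gradientFields (T : ℝ) (ρ : ℝ → Torus d → ℝ) :
    Submodule ℝ (Lp (Vec d) 2 (spaceTime T d)) where
  carrier := {u | ∃ ψ, SmoothSpaceTime ψ ∧ u =ᵐ[spaceTime T d] sqrtGrad ρ ψ}
  zero_mem' := by
    refine ⟨fun _ _ => 0, contDiff_const, ?_⟩
    filter_upwards [Lp.coeFn_zero (Vec d) 2 (spaceTime T d)] with z hz
    have : grad (fun _ : Torus d => (0 : ℝ)) z.2 = 0 := by ext i; simp [grad, partialD]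
    exact hz.trans (by simp [sqrtGrad, this])
  add_mem' := by
    rintro u v ⟨ψ, hψ, hu⟩ ⟨χ, hχ, hv⟩
    refine ⟨_, hψ.add hχ, ?_⟩
    filter_upwards [Lp.coeFn_add u v, hu, hv] with z h1 h2 h3
    rw [h1, Pi.add_apply, h2, h3]
    simp only [sqrtGrad]
    rw [grad_add (hψ.smoothTorus _) (hχ.smoothTorus _), smul_add]
  smul_mem' := by
    rintro c u ⟨ψ, hψ, hu⟩
    refine ⟨fun t x => c * ψ t x, ContDiff.mul contDiff_const hψ, ?_⟩
    filter_upwards [Lp.coeFn_smul c u, hu] with z h1 h2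
    rw [h1, Pi.smul_apply, h2]
    simp only [sqrtGrad]
    rw [grad_const_mul, smul_comm]

lemma inner_Lp_eq {u v : Lp (Vec d) 2 (spaceTime T d)} {f g : ℝ × Torus d → Vec d}
    (hu : u =ᵐ[spaceTime T d] f) (hv : v =ᵐ[spaceTime T d] g) :
    inner ℝ u v = ∫ z, inner ℝ (f z) (g z) ∂(spaceTime T d) := by
  rw [L2.inner_def]
  refine integral_congr_ae ?_
  filter_upwards [hu, hv] with z h1 h2
  rw [h1, h2]

lemma IsWeakSolution.parFunctional_eq_inner {V : ℝ → Torus d → Vec d} {ρ : ℝ → Torus d → ℝ}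
    {g : ℝ → Torus d → Vec d} (hT : 0 < T) (hρ : ContinuousInL1 T ρ)
    (h : IsWeakSolution T V g (ρ 0) ρ) (hg : MemLp (Function.uncurry g) 2 (spaceTime T d))
    {ψ : ℝ → Torus d → ℝ} (hψ : SmoothSpaceTime ψ) {u : Lp (Vec d) 2 (spaceTime T d)}
    (hu : u =ᵐ[spaceTime T d] sqrtGrad ρ ψ) :
    parFunctional T V ρ ψ = inner ℝ (hg.toLp _) u - 1 / 2 * ‖u‖ ^ 2 := by
  rw [h.parFunctional_eq hT hρ hg hψ, inner_Lp_eq hg.coeFn_toLp hu,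
    ← real_inner_self_eq_norm_sq, inner_Lp_eq hu hu]
  simp only [real_inner_self_eq_norm_sq]

/-- Completing the square: `⟨g, u⟩ - ½‖u‖² = ½‖g‖² - ½‖g - u‖²`. -/
lemma IsWeakSolution.ratePar_le {V : ℝ → Torus d → Vec d} {ρ : ℝ → Torus d → ℝ}
    {g : ℝ → Torus d → Vec d} (hT : 0 < T) (hρ : ContinuousInL1 T ρ)
    (h : IsWeakSolution T V g (ρ 0) ρ) (hg : MemLp (Function.uncurry g) 2 (spaceTime T d)) :
    ratePar T V ρ ≤ ((1 / 2 * ‖hg.toLp (Function.uncurry g)‖ ^ 2 : ℝ) : EReal) := by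
  refine sSup_le ?_
  rintro _ ⟨ψ, hψ, rfl⟩
  have hm := memLp_sqrtGrad (integrable_of_memMixedLp h.memLp) hψ
  rw [h.parFunctional_eq_inner hT hρ hg hψ hm.coeFn_toLp, EReal.coe_le_coe_iff]
  have := norm_sub_sq_real (hg.toLp (Function.uncurry g)) (hm.toLp (sqrtGrad ρ ψ))
  have h0 := sq_nonneg ‖hg.toLp (Function.uncurry g) - hm.toLp (sqrtGrad ρ ψ)‖
  linarith

/-- The control of least norm: the projection of any control onto the closure of the fields
`√ρ ∇ψ`. -/
lemma IsWeakSolution.exists_optimal {V : ℝ → Torus d → Vec d} {ρ : ℝ → Torus d → ℝ}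
    {g : ℝ → Torus d → Vec d} (hT : 0 < T) (hρ : ContinuousInL1 T ρ)
    (h : IsWeakSolution T V g (ρ 0) ρ) (hg : MemLp (Function.uncurry g) 2 (spaceTime T d)) :
    ∃ (g' : ℝ → Torus d → Vec d) (hg' : MemLp (Function.uncurry g') 2 (spaceTime T d)),
      IsWeakSolution T V g' (ρ 0) ρ ∧
      ratePar T V ρ = ((1 / 2 * ‖hg'.toLp (Function.uncurry g')‖ ^ 2 : ℝ) : EReal) := by
  set K := (gradientFields T ρ).topologicalClosure
  have : CompleteSpace K := (gradientFields T ρ).isClosed_topologicalClosure.completeSpace_coe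
  set q : Lp (Vec d) 2 (spaceTime T d) := K.starProjection (hg.toLp _)
  have hqK : q ∈ K := Submodule.starProjection_apply_mem K _
  have hg' : MemLp (Function.uncurry fun t x => q (t, x)) 2 (spaceTime T d) := Lp.memLp q
  have hqL : hg'.toLp _ = q := Lp.toLp_coeFn q (Lp.memLp q)
  -- `g - q` is orthogonal to the closure, so `g` and `q` pair equally with every field.
  have horth : ∀ u ∈ gradientFields T ρ, inner ℝ q u = inner ℝ (hg.toLp _) u := fun u hu => by
    have := Submodule.starProjection_inner_eq_zero (K := K) (hg.toLp _) u
      ((gradientFields T ρ).le_topologicalClosure hu)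
    rw [inner_sub_left] at this
    linarith
  have hw : IsWeakSolution T V (fun t x => q (t, x)) (ρ 0) ρ := by
    refine h.congr_control hg hg' fun ψ hψ => ?_
    have hm := memLp_sqrtGrad (integrable_of_memMixedLp h.memLp) hψ
    have := horth (hm.toLp _) ⟨ψ, hψ, hm.coeFn_toLp⟩
    rwa [← hqL, inner_Lp_eq hg'.coeFn_toLp hm.coeFn_toLp,
      inner_Lp_eq hg.coeFn_toLp hm.coeFn_toLp] at this
  refine ⟨_, hg', hw, le_antisymm (hw.ratePar_le hT hρ hg') ?_⟩
  rw [hqL]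
  -- The bound by `ratePar` is a closed condition on `u`; it passes from the fields to their closure
  -- and can be evaluated at `u = q`.
  have hclosed : IsClosed {u : Lp (Vec d) 2 (spaceTime T d) |
      ((inner ℝ q u - 1 / 2 * ‖u‖ ^ 2 : ℝ) : EReal) ≤ ratePar T V ρ} :=
    isClosed_le (continuous_coe_real_ereal.comp (by fun_prop)) continuous_const
  have hsub : (gradientFields T ρ : Set (Lp (Vec d) 2 (spaceTime T d))) ⊆
      {u | ((inner ℝ q u - 1 / 2 * ‖u‖ ^ 2 : ℝ) : EReal) ≤ ratePar T V ρ} := by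
    rintro u ⟨ψ, hψ, hu⟩
    rw [mem_ofPred_eq, ratePar]
    refine le_sSup ⟨ψ, hψ, ?_⟩
    rw [hw.parFunctional_eq_inner hT hρ hg' hψ hu, hqL]
  have hmem : ((inner ℝ q q - 1 / 2 * ‖q‖ ^ 2 : ℝ) : EReal) ≤ ratePar T V ρ :=
    closure_minimal hsub hclosed hqK
  rw [real_inner_self_eq_norm_sq] at hmem
  convert hmem using 2
  ring

lemma half_mul_eLpNorm_sq {g : ℝ × Torus d → Vec d} (hg : MemLp g 2 (spaceTime T d)) :
    (1 / 2) * eLpNorm g 2 (spaceTime T d) ^ 2 = ENNReal.ofReal (1 / 2 * ‖hg.toLp g‖ ^ 2) := by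
  rw [Lp.norm_toLp, ENNReal.ofReal_mul (by norm_num), ENNReal.ofReal_pow ENNReal.toReal_nonneg,
    ENNReal.ofReal_toReal hg.2.ne]
  congr 1
  rw [ENNReal.ofReal_div_of_pos two_pos]
  simp

end DeanKawasaki

/-! ### Equality of the two rate functions -/

theorem proposition8 {d : ℕ} (hd : 2 ≤ d) {T : ℝ} (hT : 0 < T)
    (V : ℝ → DeanKawasaki.Torus d → DeanKawasaki.Vec d)
    (hV₁ : DeanKawasaki.AssumptionA1 T V) (hV₂ : DeanKawasaki.AssumptionA2 T V)
    (ρ : ℝ → DeanKawasaki.Torus d → ℝ) (hρ : DeanKawasaki.ContinuousInL1 T ρ)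
    (hI : DeanKawasaki.rateDK T V ρ < ⊤) (hpar : DeanKawasaki.ratePar T V ρ < ⊤) :
    ((DeanKawasaki.rateDK T V ρ : ENNReal) : EReal) = DeanKawasaki.ratePar T V ρ := by
  have hcond : DeanKawasaki.ContinuousInL1 T ρ ∧ DeanKawasaki.Ent (ρ 0) := by
    by_contra hc
    rw [DeanKawasaki.rateDK, if_neg hc] at hI
    exact lt_irrefl _ hI
  rw [DeanKawasaki.rateDK, if_pos hcond] at hI ⊢
  obtain ⟨_, g, hg, hsol, -⟩ : {c : ENNReal | ∃ g : ℝ → DeanKawasaki.Torus d →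
      DeanKawasaki.Vec d, MemLp (Function.uncurry g) 2 (DeanKawasaki.spaceTime T d) ∧
      DeanKawasaki.IsWeakSolution T V g (ρ 0) ρ ∧
      c = eLpNorm (Function.uncurry g) 2 (DeanKawasaki.spaceTime T d) ^ 2}.Nonempty := by
    -- Without controls the infimum is `⊤`, contradicting finiteness.
    by_contra hne
    rw [Set.not_nonempty_iff_eq_empty] at hne
    rw [hne, sInf_empty, ENNReal.mul_top (by simp)] at hI
    exact lt_irrefl _ hI
  obtain ⟨g', hg', hsol', hrate⟩ := hsol.exists_optimal hT hρ hg
  have hval : (1 / 2) * sInf {c : ENNReal | ∃ g : ℝ → DeanKawasaki.Torus d →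
      DeanKawasaki.Vec d, MemLp (Function.uncurry g) 2 (DeanKawasaki.spaceTime T d) ∧
      DeanKawasaki.IsWeakSolution T V g (ρ 0) ρ ∧
      c = eLpNorm (Function.uncurry g) 2 (DeanKawasaki.spaceTime T d) ^ 2} =
      (1 / 2) * eLpNorm (Function.uncurry g') 2 (DeanKawasaki.spaceTime T d) ^ 2 := by
    congr 1
    refine le_antisymm (sInf_le ⟨g', hg', hsol', rfl⟩) (le_sInf ?_)
    rintro _ ⟨k, hk, hsolk, rfl⟩
    -- `ratePar` equals `½‖g'‖²` and is at most `½‖k‖²` for any competitor `k`, so `g'` attains the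
    -- infimum.
    have hle := hsolk.ratePar_le hT hρ hk
    rw [hrate, EReal.coe_le_coe_iff] at hle
    have hnorm : ‖hg'.toLp (Function.uncurry g')‖ ≤ ‖hk.toLp (Function.uncurry k)‖ :=
      (sq_le_sq₀ (norm_nonneg _) (norm_nonneg _)).1 (by linarith)
    rw [Lp.norm_toLp, Lp.norm_toLp, ENNReal.toReal_le_toReal hg'.2.ne hk.2.ne] at hnorm
    gcongr
  rw [hval, DeanKawasaki.half_mul_eLpNorm_sq hg', hrate, EReal.coe_ennreal_ofReal,
    max_eq_left (by positivity)]
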